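/- Let $k\ge 1$. The Aztec diamond $A_k$ (drawn turned by $45^\circ$) is the following plane bipartite graph. Its vertices are the points $(x,y)\in\{0,\dots,2k\}^2$ with $x+y$ odd, white if $x$ is even and black if $x$ is odd; two vertices are adjacent if they differ by $(\pm1,\pm1)$. Its set $F$ of faces is indexed by the points $(x,y)\in\{0,\dots,2k\}^2$ with $x+y$ even; the face is inner if $0<x,y<2k$ and open otherwise. The degree $\deg(f)$ of a face is the number of edges of $A_k$ adjacent to it. Each face $f$ carries a weight $a_f$; write $c_{i,j}=a_{(2i,2j)}$ for $0\le i,j\le k$ and $d_{i,j}=a_{(2i+1,2j+1)}$ for $0\le i,j\le k-1$. A Kasteleyn orientation is a skew-symmetric function $\varphi$ from the directed edges to $\{-1,1\}$ such that for every inner face of degree $2m$ the product of $\varphi_{(w,b)}$ over the edges $wb$ of its boundary ($w$ white, $b$ black) is $(-1)^{m+1}$. An oriented dimer configuration is a set $\vec{\mathsf M}$ of directed edges such that every vertex is an end point of exactly one element of $\vec{\mathsf M}$. With $f(\vec e)$ the face on the right of $\vec e$, put \[ Z(A_k,a,\varphi)=\sum_{\vec{\mathsf M}}\ \prod_{\vec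 e\in\vec{\mathsf M}}\varphi_{\vec e}\,a_{f(\vec e)},\qquad Y(A_k,a)=C(A_k,a)\,\frac{Z(A_k,a^{-1},\varphi)}{Z(A_k,a,\varphi)}, \] where $C(A_k,a)=\mathrm{i}^{|V|}\prod_{f\ \mathrm{inner}}a_f^{\deg(f)/2-1}\prod_{f\ \mathrm{open}}a_f^{\lceil \deg(f)/2\rceil}$, $|V|$ is the number of vertices, and $a^{-1}=(a_f^{-1})_f$. The formula for $Y$ is used literally for finite nonzero weights with $Z(A_k,a,\varphi)\neq0$. For other weights $a\in(\mathbb C\cup\{\infty\})^F$, the value $Y(A_k,a)$ is the limit in $\mathbb C\cup\{\infty\}$, when it exists, of $Y(A_k,b)$ as finite nonzero weights $b$ with $Z(A_k,b,\varphi)\ne0$ tend to $a$. Suppose that $d_{i,j}=d\in\mathbb C$ for all $0\le i,j\le k-1$ and that $c_{i,j}\neq d$ for all $0\le i,j\le k$. Let $N$ be the $(k+1)\times(k+1)$ matrix with entries $N_{i,j}=\frac1{c_{i,j}-d}$. Let $\varphi$ be any Kasteleyn orientation of $A_k$. 1. If the $c_{i,j}$ are finite, then \[ Z(A_k,a,\varphi)=\pm\prod_{0\le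 i,j\le k}(c_{i,j}-d)\cdot\det N, \] where the sign depends on $k$ and $\varphi$ only. 2. If $\det N\neq0$, then $Y(A_k,a)$ is well defined and \[ Y(A_k,a)=d+\sum_{0\le i,j\le k}(N^{-1})_{i,j}. \] This holds for finite nonzero weights, where $Z(A_k,a,\varphi)\ne0$ and the defining formula of $Y$ applies literally, and also when some weights are $0$ or some $c_{i,j}$ are $\infty$ (with $\frac1{\infty-d}=0$). -/

import Mathlib

open Filter Topology

namespace AztecDimers

/-- Points of the plane carrying the faces and the vertices of the Aztec diamond. -/
abbrev Pt := ℤ × ℤ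

/-- The faces (inner and open) of the Aztec diamond `A_k` turned by 45 degrees: the face centred
at `(x, y)`, with `0 ≤ x, y ≤ 2k` and `x + y` even. -/
noncomputable def faces (k : ℕ) : Finset Pt :=
  (Finset.Icc (0 : ℤ) (2 * k) ×ˢ Finset.Icc (0 : ℤ) (2 * k)).filter fun p => Even (p.1 + p.2)

/-- The vertices of `A_k`: the points `(x, y)` with `0 ≤ x, y ≤ 2k` and `x + y` odd. -/
noncomputable def vertices (k : ℕ) : Finset Pt :=
  (Finset.Icc (0 : ℤ) (2 * k) ×ˢ Finset.Icc (0 : ℤ) (2 * k)).filter fun p => Odd (p.1 + p.2)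

/-- A vertex is white when its abscissa is even (the leftmost and rightmost vertices are white),
and black otherwise (the lowest and highest vertices are black). -/
def IsWhite (v : Pt) : Prop := Even v.1

instance : DecidablePred IsWhite := fun v => inferInstanceAs (Decidable (Even v.1))

/-- The inner faces of `A_k`, i.e. those not on the border of the square `[0, 2k]²`. -/
noncomputable def innerFaces (k : ℕ) : Finset Pt :=
  (faces k).filter fun p => (0 < p.1 ∧ p.1 < 2 * (k : ℤ)) ∧ (0 < p.2 ∧ p.2 < 2 * (k : ℤ))

/-- The open faces of `A_k`. -/
noncomputable def openFaces (k : ℕ) : Finset Pt := faces k \ innerFaces k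

/-- The directed edges of `A_k`: two vertices are adjacent when they differ by `(±1, ±1)`;
every edge occurs with its two orientations. -/
noncomputable def darts (k : ℕ) : Finset (Pt × Pt) :=
  (vertices k ×ˢ vertices k).filter fun e => |e.1.1 - e.2.1| = 1 ∧ |e.1.2 - e.2.2| = 1

/-- The face on the right of the directed edge `e`: the midpoint of `e` plus half of the direction
of `e` turned clockwise by a right angle. For adjacent end points both divisions are exact. -/
def rightFace (e : Pt × Pt) : Pt :=
  ((e.1.1 + e.2.1 + (e.2.2 - e.1.2)) / 2, (e.1.2 + e.2.2 - (e.2.1 - e.1.1)) / 2)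

/-- The edges on the boundary of the face `f`, each one directed from its white end point to its
black one. -/
noncomputable def boundary (k : ℕ) (f : Pt) : Finset (Pt × Pt) :=
  (darts k).filter fun e => IsWhite e.1 ∧ (rightFace e = f ∨ rightFace e.swap = f)

/-- The degree of a face: the number of edges of `A_k` adjacent to it. -/
noncomputable def faceDegree (k : ℕ) (f : Pt) : ℕ := (boundary k f).card

/-- Kasteleyn orientations of `A_k`: skew-symmetric functions on directed edges, with values in
`{-1, 1}`, whose product around every inner face of degree `2m` is `(-1)^(m+1)`. -/
structure IsKasteleyn (k : ℕ) (φ : Pt × Pt → ℤ) : Prop where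
  values : ∀ e ∈ darts k, φ e = 1 ∨ φ e = -1
  skew : ∀ e ∈ darts k, φ e.swap = -φ e
  face : ∀ f ∈ innerFaces k, ∏ e ∈ boundary k f, φ e = (-1) ^ (faceDegree k f / 2 + 1)

open Classical in
/-- The oriented dimer configurations of `A_k`: sets of directed edges such that every vertex is an
end point of exactly one of them. -/
noncomputable def orientedDimers (k : ℕ) : Finset (Finset (Pt × Pt)) :=
  (darts k).powerset.filter fun M =>
    ∀ v ∈ vertices k, ∃! e, e ∈ M ∧ (e.1 = v ∨ e.2 = v)

/-- The partition function `Z(A_k, a, φ)` of oriented dimers. Only the values of `a` on the faces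
of `A_k` and the values of `φ` on the directed edges of `A_k` matter. -/
noncomputable def Z (k : ℕ) (a : Pt → ℂ) (φ : Pt × Pt → ℤ) : ℂ :=
  ∑ M ∈ orientedDimers k, ∏ e ∈ M, (φ e : ℂ) * a (rightFace e)

/-- The normalization `C(A_k, a)`; the natural number `(n + 1) / 2` is the ceiling of `n / 2`. -/
noncomputable def normalization (k : ℕ) (a : Pt → ℂ) : ℂ :=
  Complex.I ^ (vertices k).card * (∏ f ∈ innerFaces k, a f ^ (faceDegree k f / 2 - 1)) *
    ∏ f ∈ openFaces k, a f ^ ((faceDegree k f + 1) / 2)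

/-- The expression `C(A_k, a) * Z(A_k, a⁻¹, φ) / Z(A_k, a, φ)` defining the ratio function
`Y(A_k, a)`. It is meaningful as it stands for finite nonzero weights with `Z(A_k, a, φ) ≠ 0`;
see `HasRatio` for the other weights. -/
noncomputable def Y (k : ℕ) (a : Pt → ℂ) (φ : Pt × Pt → ℤ) : ℂ :=
  normalization k a * (Z k (fun f => (a f)⁻¹) φ / Z k a φ)

/-- The finite weights at which the expression `Y` can be evaluated literally. -/
def regularWeights (k : ℕ) (φ : Pt × Pt → ℤ) : Set (Pt → ℂ) :=
  {b | (∀ f ∈ faces k, b f ≠ 0) ∧ Z k b φ ≠ 0}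

/-- The filter of the regular finite weights `b` tending to the weights `a`, which take values in
the Riemann sphere. -/
noncomputable def approach (k : ℕ) (φ : Pt × Pt → ℤ) (a : Pt → OnePoint ℂ) : Filter (Pt → ℂ) :=
  comap (fun b f => (b f : OnePoint ℂ)) (𝓝 a) ⊓ 𝓟 (regularWeights k φ)

/-- For weights `a` in the Riemann sphere (`0` and `∞` allowed), `HasRatio k φ a y` says that the
rational function `Y(A_k, ·)` of all the face weights is well defined at `a`, with value `y`:
regular weights come arbitrarily close to `a`, and `Y` tends to `y` along them. -/
def HasRatio (k : ℕ) (φ : Pt × Pt → ℤ) (a : Pt → OnePoint ℂ) (y : OnePoint ℂ) : Prop :=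
  (approach k φ a).NeBot ∧ Tendsto (fun b => (Y k b φ : OnePoint ℂ)) (approach k φ a) (𝓝 y)

/-- The even face `(2i, 2j)`, whose weight is called `c_{i,j}`. -/
def evenFace {k : ℕ} (i j : Fin (k + 1)) : Pt := (2 * ((i : ℕ) : ℤ), 2 * ((j : ℕ) : ℤ))

/-- The odd face `(2i+1, 2j+1)`, whose weight is called `d_{i,j}`. -/
def oddFace {k : ℕ} (i j : Fin k) : Pt := (2 * ((i : ℕ) : ℤ) + 1, 2 * ((j : ℕ) : ℤ) + 1)

/-- `1 / (c - d)` for `c` in the Riemann sphere and finite `d ≠ c`, with `1 / (∞ - d) = 0`. -/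
noncomputable def invSub (c : OnePoint ℂ) (d : ℂ) : ℂ := OnePoint.elim c 0 fun z => 1 / (z - d)

end AztecDimers

/-! Summing over the two directions of each edge and using skew-symmetry turns `Z` into a signed sum
over perfect matchings of products of `φ(w, b) * (a_right - a_left)`. Every edge separates one even
face from one odd face, so up to sign its factor is a difference `c - d`.

Kasteleyn's theorem is proved by hand. Call an edge north-east if it leads from its white end to the
upper right; every inner face has exactly one such edge. The reference orientation, `-1` on these
and `1` elsewhere, therefore satisfies the face condition, and any Kasteleyn orientation is gauge
equivalent to it (`exists_gauge`). With vertices enumerated by columns, inversions of a matching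
occur only within one white or one black column, and their number has, up to a constant, the parity
of the number of north-east edges (`exists_sign_matching`). Hence `Z = ± det (dimerMatrix)`.

If all odd weights equal `d`, the dimer matrix is a block of a larger matrix which factors as
unitriangular times diagonal times unitriangular, with determinant `∏ (c - d)`. The complementary
block of its inverse is the transpose of `N`, so Jacobi's complementary minor identity gives part 1.

For part 2, inverting the weights replaces `N` by `-d² (N + d⁻¹ J)`, `J` being the all-ones matrix.
The determinant of a rank one perturbation brings in the sum of the entries of `N⁻¹`, and all other
factors cancel to leave `d`.

For weights `0` or `∞`, put `a = s / t`. Clearing denominators makes `Z` a polynomial `homogeneousZ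
s t`, and `Y = homogeneousZ t s / homogeneousZ s t` extends continuously wherever the denominator is
nonzero. Both this nonvanishing and the value of the limit are read off along one curve of finite
weights with uniform odd weight, where the finite case applies. -/

namespace AztecDimers

/-! ### Oriented dimers as perfect matchings with a choice of directions -/

/-- The white vertex `(2i, 2j+1)`. -/
def whitePt {k : ℕ} (w : Fin (k + 1) × Fin k) : Pt :=
  (2 * ((w.1 : ℕ) : ℤ), 2 * ((w.2 : ℕ) : ℤ) + 1)

/-- The black vertex `(2p+1, 2q)`. -/
def blackPt {k : ℕ} (b : Fin k × Fin (k + 1)) : Pt :=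
  (2 * ((b.1 : ℕ) : ℤ) + 1, 2 * ((b.2 : ℕ) : ℤ))

/-- Adjacency of a white and a black vertex, in terms of their indices. -/
def Adj {k : ℕ} (w : Fin (k + 1) × Fin k) (b : Fin k × Fin (k + 1)) : Prop :=
  ((b.1 : ℕ) = w.1 ∨ (b.1 : ℕ) + 1 = w.1) ∧ ((b.2 : ℕ) = w.2 ∨ (b.2 : ℕ) = w.2 + 1)

instance {k : ℕ} (w : Fin (k + 1) × Fin k) (b : Fin k × Fin (k + 1)) : Decidable (Adj w b) :=
  inferInstanceAs (Decidable (_ ∧ _))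

lemma whitePt_injective {k : ℕ} : Function.Injective (whitePt (k := k)) := by
  rintro ⟨i, j⟩ ⟨i', j'⟩ h
  simp only [whitePt, Prod.mk.injEq] at h
  ext <;> simp <;> omega

lemma blackPt_injective {k : ℕ} : Function.Injective (blackPt (k := k)) := by
  rintro ⟨i, j⟩ ⟨i', j'⟩ h
  simp only [blackPt, Prod.mk.injEq] at h
  ext <;> simp <;> omega

lemma whitePt_ne_blackPt {k : ℕ} (w : Fin (k + 1) × Fin k) (b : Fin k × Fin (k + 1)) :
    whitePt w ≠ blackPt b := by
  intro h
  simp only [whitePt, blackPt, Prod.mk.injEq] at h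
  omega

lemma whitePt_mem {k : ℕ} (w : Fin (k + 1) × Fin k) : whitePt w ∈ vertices k := by
  obtain ⟨i, j⟩ := w
  simp only [vertices, whitePt, Finset.mem_filter, Finset.mem_product, Finset.mem_Icc]
  refine ⟨by omega, i + j, by ring⟩

lemma blackPt_mem {k : ℕ} (b : Fin k × Fin (k + 1)) : blackPt b ∈ vertices k := by
  obtain ⟨i, j⟩ := b
  simp only [vertices, blackPt, Finset.mem_filter, Finset.mem_product, Finset.mem_Icc]
  refine ⟨by omega, i + j, by ring⟩

lemma mem_vertices_iff {k : ℕ} (v : Pt) :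
    v ∈ vertices k ↔ (∃ w : Fin (k + 1) × Fin k, v = whitePt w) ∨
      ∃ b : Fin k × Fin (k + 1), v = blackPt b := by
  constructor
  · obtain ⟨x, y⟩ := v
    intro h
    simp only [vertices, Finset.mem_filter, Finset.mem_product, Finset.mem_Icc] at h
    obtain ⟨h, m, hm⟩ := h
    rcases Int.even_or_odd' x with ⟨i, hi | hi⟩
    · left
      refine ⟨(⟨i.toNat, by omega⟩, ⟨((y - 1) / 2).toNat, by omega⟩), ?_⟩
      simp only [whitePt, Prod.mk.injEq]
      omega
    · right
      refine ⟨(⟨i.toNat, by omega⟩, ⟨(y / 2).toNat, by omega⟩), ?_⟩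
      simp only [blackPt, Prod.mk.injEq]
      omega
  · rintro (⟨w, rfl⟩ | ⟨b, rfl⟩)
    exacts [whitePt_mem w, blackPt_mem b]

lemma mem_darts_white_black {k : ℕ} (w : Fin (k + 1) × Fin k) (b : Fin k × Fin (k + 1)) :
    (whitePt w, blackPt b) ∈ darts k ↔ Adj w b := by
  simp only [darts, Finset.mem_filter, Finset.mem_product, whitePt_mem, blackPt_mem, true_and,
    and_self]
  simp only [whitePt, blackPt, Adj, abs_eq (zero_le_one (α := ℤ))]
  omega

lemma mem_darts_black_white {k : ℕ} (w : Fin (k + 1) × Fin k) (b : Fin k × Fin (k + 1)) :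
    (blackPt b, whitePt w) ∈ darts k ↔ Adj w b := by
  simp only [darts, Finset.mem_filter, Finset.mem_product, whitePt_mem, blackPt_mem, true_and,
    and_self]
  simp only [whitePt, blackPt, Adj, abs_eq (zero_le_one (α := ℤ))]
  omega

lemma mem_darts_iff {k : ℕ} (e : Pt × Pt) :
    e ∈ darts k ↔ ∃ (w : Fin (k + 1) × Fin k) (b : Fin k × Fin (k + 1)), Adj w b ∧
      (e = (whitePt w, blackPt b) ∨ e = (blackPt b, whitePt w)) := by
  constructor
  · obtain ⟨u, v⟩ := e
    intro h
    have h' := h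
    simp only [darts, Finset.mem_filter, Finset.mem_product] at h
    obtain ⟨⟨hu, hv⟩, h1, h2⟩ := h
    rw [mem_vertices_iff] at hu hv
    rcases hu with ⟨w, rfl⟩ | ⟨b, rfl⟩ <;> rcases hv with ⟨w', rfl⟩ | ⟨b', rfl⟩
    · simp only [whitePt, abs_eq (zero_le_one (α := ℤ))] at h1
      omega
    · exact ⟨w, b', (mem_darts_white_black w b').1 h', Or.inl rfl⟩
    · exact ⟨w', b, (mem_darts_black_white w' b).1 h', Or.inr rfl⟩
    · simp only [blackPt, abs_eq (zero_le_one (α := ℤ))] at h1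
      omega
  · rintro ⟨w, b, h, rfl | rfl⟩
    exacts [(mem_darts_white_black w b).2 h, (mem_darts_black_white w b).2 h]

/-- The edge `wb`, directed from white to black when `o` is true and from black to white
otherwise. -/
def orientedEdge {k : ℕ} (o : Bool) (w : Fin (k + 1) × Fin k) (b : Fin k × Fin (k + 1)) :
    Pt × Pt :=
  if o then (whitePt w, blackPt b) else (blackPt b, whitePt w)

lemma orientedEdge_mem_darts {k : ℕ} (o : Bool) (w : Fin (k + 1) × Fin k)
    (b : Fin k × Fin (k + 1)) : orientedEdge o w b ∈ darts k ↔ Adj w b := by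
  cases o
  exacts [mem_darts_black_white w b, mem_darts_white_black w b]

lemma orientedEdge_inj {k : ℕ} {o o' : Bool} {w w' : Fin (k + 1) × Fin k}
    {b b' : Fin k × Fin (k + 1)} (h : orientedEdge o w b = orientedEdge o' w' b') :
    o = o' ∧ w = w' ∧ b = b' := by
  have hn := fun (w : Fin (k + 1) × Fin k) (b : Fin k × Fin (k + 1)) => whitePt_ne_blackPt w b
  cases o <;> cases o' <;> simp only [orientedEdge, Prod.mk.injEq, if_true, if_false,
    Bool.false_eq_true] at h
  · exact ⟨rfl, whitePt_injective h.2, blackPt_injective h.1⟩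
  · exact absurd h.1.symm (hn _ _)
  · exact absurd h.1 (hn _ _)
  · exact ⟨rfl, whitePt_injective h.1, blackPt_injective h.2⟩

lemma orientedEdge_white {k : ℕ} {o : Bool} {w w' : Fin (k + 1) × Fin k}
    {b : Fin k × Fin (k + 1)} :
    ((orientedEdge o w b).1 = whitePt w' ∨ (orientedEdge o w b).2 = whitePt w') ↔ w = w' := by
  have hn := fun (w : Fin (k + 1) × Fin k) (b : Fin k × Fin (k + 1)) => whitePt_ne_blackPt w b
  cases o <;> simp [orientedEdge, (hn _ _).symm, whitePt_injective.eq_iff]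

lemma orientedEdge_black {k : ℕ} {o : Bool} {w : Fin (k + 1) × Fin k}
    {b b' : Fin k × Fin (k + 1)} :
    ((orientedEdge o w b).1 = blackPt b' ∨ (orientedEdge o w b).2 = blackPt b') ↔ b = b' := by
  have hn := fun (w : Fin (k + 1) × Fin k) (b : Fin k × Fin (k + 1)) => whitePt_ne_blackPt w b
  cases o <;> simp [orientedEdge, hn, blackPt_injective.eq_iff]

lemma exists_orientedEdge {k : ℕ} {e : Pt × Pt} (h : e ∈ darts k) :
    ∃ (o : Bool) (w : Fin (k + 1) × Fin k) (b : Fin k × Fin (k + 1)),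
      Adj w b ∧ e = orientedEdge o w b := by
  obtain ⟨w, b, hwb, h | h⟩ := (mem_darts_iff e).1 h
  exacts [⟨true, w, b, hwb, h⟩, ⟨false, w, b, hwb, h⟩]

open Classical in
lemma exists_matching_of_mem_orientedDimers {k : ℕ} {M : Finset (Pt × Pt)}
    (hM : M ∈ orientedDimers k) :
    ∃ (τ : Fin (k + 1) × Fin k ≃ Fin k × Fin (k + 1)) (o : Fin (k + 1) × Fin k → Bool),
      (∀ w, Adj w (τ w)) ∧ M = Finset.univ.image fun w => orientedEdge (o w) w (τ w) := by
  simp only [orientedDimers, Finset.mem_filter, Finset.mem_powerset] at hM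
  obtain ⟨hsub, huniq⟩ := hM
  have hw : ∀ w : Fin (k + 1) × Fin k, ∃ (o : Bool) (b : Fin k × Fin (k + 1)),
      Adj w b ∧ orientedEdge o w b ∈ M := by
    intro w
    obtain ⟨e, ⟨heM, he⟩, -⟩ := huniq _ (whitePt_mem w)
    obtain ⟨o, w', b, hadj, rfl⟩ := exists_orientedEdge (hsub heM)
    obtain rfl := orientedEdge_white.1 he
    exact ⟨o, b, hadj, heM⟩
  choose o t hadj hmem using hw
  have hinj : Function.Injective t := by
    intro w w' hww
    have h := (huniq _ (blackPt_mem (t w))).unique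
      ⟨hmem w, orientedEdge_black.2 rfl⟩ ⟨hmem w', orientedEdge_black.2 hww.symm⟩
    exact (orientedEdge_inj h).2.1
  -- There are `k (k + 1)` vertices of each colour, so injectivity is enough.
  have hbij : Function.Bijective t := by
    rw [Fintype.bijective_iff_injective_and_card]
    exact ⟨hinj, by simp [mul_comm]⟩
  refine ⟨Equiv.ofBijective t hbij, o, hadj, ?_⟩
  ext e
  simp only [Finset.mem_image, Finset.mem_univ, true_and, Equiv.ofBijective_apply]
  constructor
  · intro he
    obtain ⟨o', w, b, -, rfl⟩ := exists_orientedEdge (hsub he)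
    exact ⟨w, (huniq _ (whitePt_mem w)).unique
      ⟨hmem w, orientedEdge_white.2 rfl⟩ ⟨he, orientedEdge_white.2 rfl⟩⟩
  · rintro ⟨w, rfl⟩
    exact hmem w

open Classical in
lemma image_orientedEdge_mem {k : ℕ} (τ : Fin (k + 1) × Fin k ≃ Fin k × Fin (k + 1))
    (o : Fin (k + 1) × Fin k → Bool) (h : ∀ w, Adj w (τ w)) :
    (Finset.univ.image fun w => orientedEdge (o w) w (τ w)) ∈ orientedDimers k := by
  simp only [orientedDimers, Finset.mem_filter, Finset.mem_powerset]
  constructor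
  · intro e he
    simp only [Finset.mem_image, Finset.mem_univ, true_and] at he
    obtain ⟨w, rfl⟩ := he
    exact (orientedEdge_mem_darts _ _ _).2 (h w)
  · intro v hv
    rcases (mem_vertices_iff v).1 hv with ⟨w, rfl⟩ | ⟨b, rfl⟩
    · refine ⟨orientedEdge (o w) w (τ w), ⟨by simp, orientedEdge_white.2 rfl⟩, ?_⟩
      rintro e ⟨he, hw⟩
      simp only [Finset.mem_image, Finset.mem_univ, true_and] at he
      obtain ⟨w', rfl⟩ := he
      rw [orientedEdge_white.1 hw]
    · refine ⟨orientedEdge (o (τ.symm b)) (τ.symm b) (τ (τ.symm b)),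
        ⟨by simp only [Finset.mem_image, Finset.mem_univ, true_and]; exact ⟨_, rfl⟩,
          orientedEdge_black.2 (by simp)⟩, ?_⟩
      rintro e ⟨he, hw⟩
      simp only [Finset.mem_image, Finset.mem_univ, true_and] at he
      obtain ⟨w', rfl⟩ := he
      rw [← orientedEdge_black.1 hw]
      simp

/-- A sum over oriented dimer configurations is a sum over perfect matchings. -/
lemma sum_orientedDimers {k : ℕ} (g : Pt × Pt → ℂ) :
    ∑ M ∈ orientedDimers k, ∏ e ∈ M, g e =
      ∑ τ : Fin (k + 1) × Fin k ≃ Fin k × Fin (k + 1) with ∀ w, Adj w (τ w),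
        ∏ w, (g (whitePt w, blackPt (τ w)) + g (blackPt (τ w), whitePt w)) := by
  classical
  -- Expanding the product of binomials chooses a direction for each edge of the matching.
  have hexp : ∀ τ : Fin (k + 1) × Fin k ≃ Fin k × Fin (k + 1),
      ∏ w, (g (whitePt w, blackPt (τ w)) + g (blackPt (τ w), whitePt w)) =
        ∑ o : Fin (k + 1) × Fin k → Bool, ∏ w, g (orientedEdge (o w) w (τ w)) := by
    intro τ
    rw [← Fintype.prod_sum (fun w (o : Bool) => g (orientedEdge o w (τ w)))]
    simp [orientedEdge]
  simp_rw [hexp]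
  rw [← Finset.sum_product']
  symm
  refine Finset.sum_bij
    (fun x _ => Finset.univ.image fun w => orientedEdge (x.2 w) w (x.1 w)) ?_ ?_ ?_ ?_
  · rintro ⟨τ, o⟩ h
    simp only [Finset.mem_product, Finset.mem_filter, Finset.mem_univ, true_and, and_true] at h
    exact image_orientedEdge_mem τ o h
  · rintro ⟨τ, o⟩ - ⟨τ', o'⟩ - heq
    have key : ∀ w, o w = o' w ∧ τ w = τ' w := by
      intro w
      have hw : orientedEdge (o w) w (τ w) ∈
          Finset.univ.image fun w => orientedEdge (o w) w (τ w) := by simp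
      simp only at heq
      rw [heq] at hw
      simp only [Finset.mem_image, Finset.mem_univ, true_and] at hw
      obtain ⟨w', hw'⟩ := hw
      obtain ⟨h1, rfl, h3⟩ := orientedEdge_inj hw'
      exact ⟨h1.symm, h3.symm⟩
    exact Prod.ext (Equiv.ext fun w => (key w).2) (funext fun w => (key w).1)
  · intro M hM
    obtain ⟨τ, o, h, rfl⟩ := exists_matching_of_mem_orientedDimers hM
    exact ⟨(τ, o), by simpa using h, rfl⟩
  · rintro ⟨τ, o⟩ -
    rw [Finset.prod_image]
    intro w _ w' _ h
    exact (orientedEdge_inj h).2.1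

/-! ### Signs of perfect matchings by counting inversions -/

/-- The sign of a permutation, given as a bijection of two types enumerated by `Fin N`, is
determined by the number of inversions. -/
lemma sign_eq_neg_one_pow_inversions {α β : Type*} [Fintype α] {N : ℕ} (f : α ≃ Fin N)
    (g : β ≃ Fin N) (τ : α ≃ β) :
    (Equiv.Perm.sign ((f.symm.trans τ).trans g) : ℤ) =
      (-1) ^ ∑ w, ∑ w', if f w < f w' ∧ g (τ w') < g (τ w) then 1 else 0 := by
  have h : ∀ x : Fin N, (∏ z ∈ Finset.Ioi x,
      (if g (τ (f.symm x)) < g (τ (f.symm z)) then (1 : ℤ) else -1)) =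
      ∏ z, (-1) ^ (if x < z ∧ g (τ (f.symm z)) < g (τ (f.symm x)) then 1 else 0) := by
    intro x
    rw [← Finset.prod_filter_mul_prod_filter_not Finset.univ (fun z => x < z)]
    have h2 : ∏ z with ¬ x < z, (-1 : ℤ) ^
        (if x < z ∧ g (τ (f.symm z)) < g (τ (f.symm x)) then 1 else 0) = 1 := by
      refine Finset.prod_eq_one fun z hz => ?_
      simp only [Finset.mem_filter] at hz
      simp [hz.2]
    rw [h2, mul_one]
    refine Finset.prod_congr (by ext; simp) fun z hz => ?_
    simp only [Finset.mem_filter] at hz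
    have hne : g (τ (f.symm x)) ≠ g (τ (f.symm z)) := by
      simpa using hz.2.ne
    rcases lt_or_gt_of_ne hne with h | h
    · simp [h, h.not_gt]
    · simp [h, h.not_gt, hz.2]
  rw [Equiv.Perm.sign_eq_prod_prod_Ioi]
  push_cast
  simp only [Equiv.trans_apply]
  rw [← Finset.prod_pow_eq_pow_sum, ← Equiv.prod_comp f.symm]
  refine Finset.prod_congr rfl fun x _ => ?_
  rw [← Finset.prod_pow_eq_pow_sum, ← Equiv.prod_comp f.symm]
  have := h x
  simp only [Equiv.apply_symm_apply]
  rw [← this]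
  refine Finset.prod_congr rfl fun z _ => ?_
  split_ifs with h1
  · simp [h1]
  · simp [h1]

/-- An element `b` of `S` has `b` smaller elements, of which those lying in `S` contribute
`|S|.choose 2` in total. Adding a new maximum leaves the earlier pairs unchanged, which drives the
induction. -/
lemma sum_card_lt_notMem_add_choose {n : ℕ} (S : Finset (Fin n)) :
    (∑ b ∈ S, ∑ a, if a < b ∧ a ∉ S then 1 else 0) + S.card.choose 2 = ∑ b ∈ S, (b : ℕ) := by
  induction S using Finset.induction_on_max with
  | empty => simp
  | insert m S hlt ih =>
    have hm : m ∉ S := fun h => lt_irrefl _ (hlt m h)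
    rw [Finset.sum_insert hm, Finset.sum_insert hm, Finset.card_insert_of_notMem hm,
      Nat.choose_succ_succ' _ 1, Nat.choose_one_right, ← ih]
    have h1 : (∑ a, if a < m ∧ a ∉ insert m S then 1 else 0) + S.card = m := by
      rw [← Finset.card_filter]
      have : Finset.univ.filter (fun a => a < m ∧ a ∉ insert m S) = Finset.Iio m \ S := by
        ext a
        simp only [Finset.mem_filter, Finset.mem_univ, true_and, Finset.mem_insert, not_or,
          Finset.mem_sdiff, Finset.mem_Iio]
        exact ⟨fun h => ⟨h.1, h.2.2⟩, fun h => ⟨h.1, h.1.ne, h.2⟩⟩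
      rw [this, Finset.card_sdiff_add_card_eq_card, Fin.card_Iio]
      exact fun a ha => Finset.mem_Iio.2 (hlt a ha)
    have h2 : (∑ b ∈ S, ∑ a, if a < b ∧ a ∉ insert m S then 1 else 0) =
        ∑ b ∈ S, ∑ a, if a < b ∧ a ∉ S then 1 else 0 := by
      refine Finset.sum_congr rfl fun b hb => Finset.sum_congr rfl fun a _ => ?_
      have := hlt b hb
      refine if_congr ?_ rfl rfl
      simp only [Finset.mem_insert, not_or]
      exact ⟨fun h => ⟨h.1, h.2.2⟩, fun h => ⟨h.1, (h.1.trans this).ne, h.2⟩⟩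
    rw [h2]
    simp only [Nat.reduceAdd]
    omega

lemma ite_or_eq_add {A B : Prop} [Decidable A] [Decidable B] (h : A → ¬ B) :
    (if A ∨ B then 1 else 0) = (if A then 1 else 0) + if B then 1 else 0 := by
  by_cases hA : A
  · simp [hA, h hA]
  · simp [hA]

lemma finProdFinEquiv_lt_iff {m n : ℕ} (x y : Fin m × Fin n) :
    finProdFinEquiv x < finProdFinEquiv y ↔
      (x.1 : ℕ) < y.1 ∨ (x.1 : ℕ) = y.1 ∧ (x.2 : ℕ) < y.2 := by
  obtain ⟨⟨i, hi⟩, ⟨j, hj⟩⟩ := x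
  obtain ⟨⟨i', hi'⟩, ⟨j', hj'⟩⟩ := y
  simp only [Fin.lt_def, finProdFinEquiv_apply_val]
  rcases lt_trichotomy i i' with h | h | h
  · have : n * (i + 1) ≤ n * i' := Nat.mul_le_mul_left n h
    rw [mul_add] at this
    simp only [h, true_or, iff_true]
    omega
  · subst h
    simp
  · have : n * (i' + 1) ≤ n * i := Nat.mul_le_mul_left n h
    rw [mul_add] at this
    constructor
    · omega
    · omega

section Matching

variable {k : ℕ} (τ : Fin (k + 1) × Fin k ≃ Fin k × Fin (k + 1))

/-- The white vertices of the column `2i` that are matched to their left. -/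
def leftSet (i : Fin (k + 1)) : Finset (Fin k) :=
  Finset.univ.filter fun j => ((τ (i, j)).1 : ℕ) + 1 = i

/-- The black vertices of the column `2p + 1` that are matched to their left. -/
def blackLeftSet (p : Fin k) : Finset (Fin (k + 1)) :=
  Finset.univ.filter fun q => ((τ.symm (p, q)).1 : ℕ) = p

variable {τ}

/-- The matching pairs the black vertices matched to their left with the white vertices of the
preceding column that are not matched to their left. -/
lemma card_blackLeftSet_add (h : ∀ w, Adj w (τ w)) (p : Fin k) :
    (blackLeftSet τ p).card + (leftSet τ p.castSucc).card = k := by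
  have : (blackLeftSet τ p).card = ((leftSet τ p.castSucc)ᶜ).card := by
    refine Finset.card_bij' (fun q _ => (τ.symm (p, q)).2) (fun j _ => (τ (p.castSucc, j)).2)
      ?_ ?_ ?_ ?_
    · intro q hq
      simp only [blackLeftSet, Finset.mem_filter, Finset.mem_univ, true_and] at hq
      have : (p.castSucc, (τ.symm (p, q)).2) = τ.symm (p, q) := Prod.ext (Fin.ext hq.symm) rfl
      simp [leftSet, this]
    · intro j hj
      simp only [leftSet, Finset.mem_compl, Finset.mem_filter, Finset.mem_univ, true_and] at hj
      have h1 : ((τ (p.castSucc, j)).1 : ℕ) = p := by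
        have := (h (p.castSucc, j)).1
        simp only [Fin.val_castSucc] at this hj
        omega
      have : (p, (τ (p.castSucc, j)).2) = τ (p.castSucc, j) := Prod.ext (Fin.ext h1.symm) rfl
      simp [blackLeftSet, this]
    · intro q hq
      simp only [blackLeftSet, Finset.mem_filter, Finset.mem_univ, true_and] at hq
      have : (p.castSucc, (τ.symm (p, q)).2) = τ.symm (p, q) := Prod.ext (Fin.ext hq.symm) rfl
      simp [this]
    · intro j hj
      simp only [leftSet, Finset.mem_compl, Finset.mem_filter, Finset.mem_univ, true_and] at hj
      have h1 : ((τ (p.castSucc, j)).1 : ℕ) = p := by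
        have := (h (p.castSucc, j)).1
        simp only [Fin.val_castSucc] at this hj
        omega
      have : (p, (τ (p.castSucc, j)).2) = τ (p.castSucc, j) := Prod.ext (Fin.ext h1.symm) rfl
      simp [this]
  rw [this, Finset.card_compl_add_card, Fintype.card_fin]

lemma card_leftSet_succ_add (h : ∀ w, Adj w (τ w)) (p : Fin k) :
    (leftSet τ p.succ).card + (blackLeftSet τ p).card = k + 1 := by
  have : (leftSet τ p.succ).card = ((blackLeftSet τ p)ᶜ).card := by
    refine Finset.card_bij' (fun j _ => (τ (p.succ, j)).2) (fun q _ => (τ.symm (p, q)).2)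
      ?_ ?_ ?_ ?_
    · intro j hj
      simp only [leftSet, Finset.mem_filter, Finset.mem_univ, true_and, Fin.val_succ] at hj
      have : (p, (τ (p.succ, j)).2) = τ (p.succ, j) := Prod.ext (Fin.ext (by simp; omega)) rfl
      simp [blackLeftSet, this]
    · intro q hq
      simp only [blackLeftSet, Finset.mem_compl, Finset.mem_filter, Finset.mem_univ,
        true_and] at hq
      have h1 : ((τ.symm (p, q)).1 : ℕ) = p + 1 := by
        have := (h (τ.symm (p, q))).1
        simp only [Equiv.apply_symm_apply] at this
        omega
      have : (p.succ, (τ.symm (p, q)).2) = τ.symm (p, q) :=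
        Prod.ext (Fin.ext (by simp [h1])) rfl
      simp [leftSet, this]
    · intro j hj
      simp only [leftSet, Finset.mem_filter, Finset.mem_univ, true_and, Fin.val_succ] at hj
      have : (p, (τ (p.succ, j)).2) = τ (p.succ, j) := Prod.ext (Fin.ext (by simp; omega)) rfl
      simp [this]
    · intro q hq
      simp only [blackLeftSet, Finset.mem_compl, Finset.mem_filter, Finset.mem_univ,
        true_and] at hq
      have h1 : ((τ.symm (p, q)).1 : ℕ) = p + 1 := by
        have := (h (τ.symm (p, q))).1
        simp only [Equiv.apply_symm_apply] at this
        omega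
      have : (p.succ, (τ.symm (p, q)).2) = τ.symm (p, q) :=
        Prod.ext (Fin.ext (by simp [h1])) rfl
      simp [this]
  rw [this, Finset.card_compl_add_card, Fintype.card_fin]

/-- Nothing lies to the left of column `0`. The column sizes `k` (white) and `k + 1` (black) then
force the number of left edges to grow by one from each white column to the next. -/
lemma card_leftSet (h : ∀ w, Adj w (τ w)) (i : Fin (k + 1)) : (leftSet τ i).card = i := by
  induction i using Fin.induction with
  | zero => simp [leftSet]
  | succ p ih =>
    have h1 := card_blackLeftSet_add h p
    have h2 := card_leftSet_succ_add h p
    simp only [Fin.val_castSucc, Fin.val_succ] at *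
    omega

lemma card_blackLeftSet (h : ∀ w, Adj w (τ w)) (p : Fin k) :
    (blackLeftSet τ p).card = k - p := by
  have h1 := card_blackLeftSet_add h p
  have h2 := card_leftSet h p.castSucc
  simp only [Fin.val_castSucc] at *
  omega

/-- Matched vertices lie in neighbouring columns, so an inverted pair must share its white column or
its black one. If it shared both, the order of heights could not be reversed, since the black height
is the white one or one more. -/
lemma inversion_iff (h : ∀ w, Adj w (τ w)) (w w' : Fin (k + 1) × Fin k) :
    (finProdFinEquiv w < finProdFinEquiv w' ∧ finProdFinEquiv (τ w') < finProdFinEquiv (τ w)) ↔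
      (w.1 = w'.1 ∧ w.2 < w'.2 ∧ w.2 ∉ leftSet τ w.1 ∧ w'.2 ∈ leftSet τ w'.1) ∨
      ((τ w).1 = (τ w').1 ∧ (τ w').2 < (τ w).2 ∧ (τ w').2 ∉ blackLeftSet τ (τ w').1 ∧
        (τ w).2 ∈ blackLeftSet τ (τ w).1) := by
  have h1 := h w
  have h2 := h w'
  rw [finProdFinEquiv_lt_iff, finProdFinEquiv_lt_iff]
  simp only [leftSet, blackLeftSet, Finset.mem_filter, Finset.mem_univ,
    true_and, Prod.mk.eta, Equiv.symm_apply_apply, Fin.ext_iff, Fin.lt_def, Adj] at *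
  omega

lemma ite_inversion (h : ∀ w, Adj w (τ w)) (w w' : Fin (k + 1) × Fin k) :
    (if finProdFinEquiv w < finProdFinEquiv w' ∧
        finProdFinEquiv (τ w') < finProdFinEquiv (τ w) then 1 else 0) =
      (if w.1 = w'.1 then
        (if w'.2 ∈ leftSet τ w'.1 then (if w.2 < w'.2 ∧ w.2 ∉ leftSet τ w'.1 then 1 else 0)
          else 0) else 0) +
      (if (τ w').1 = (τ w).1 then
        (if (τ w).2 ∈ blackLeftSet τ (τ w).1 then
          (if (τ w').2 < (τ w).2 ∧ (τ w').2 ∉ blackLeftSet τ (τ w).1 then 1 else 0)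
          else 0) else 0) := by
  rw [if_congr (inversion_iff h w w') rfl rfl]
  have hA : (w.1 = w'.1 ∧ w.2 < w'.2 ∧ w.2 ∉ leftSet τ w.1 ∧ w'.2 ∈ leftSet τ w'.1) →
      ¬ ((τ w).1 = (τ w').1 ∧ (τ w').2 < (τ w).2 ∧ (τ w').2 ∉ blackLeftSet τ (τ w').1 ∧
        (τ w).2 ∈ blackLeftSet τ (τ w).1) := by
    have h1 := h w
    simp only [leftSet, Finset.mem_filter, Finset.mem_univ, true_and, Prod.mk.eta,
      Fin.ext_iff, Adj] at *
    omega
  have e1 : (if w.1 = w'.1 then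
        (if w'.2 ∈ leftSet τ w'.1 then (if w.2 < w'.2 ∧ w.2 ∉ leftSet τ w'.1 then 1 else 0)
          else 0) else 0) = if w.1 = w'.1 ∧ w.2 < w'.2 ∧ w.2 ∉ leftSet τ w.1 ∧
            w'.2 ∈ leftSet τ w'.1 then 1 else 0 := by
    by_cases e : w.1 = w'.1
    · simp only [e, true_and, if_true]
      rw [← ite_and]
      exact if_congr (by tauto) rfl rfl
    · simp [e]
  have e2 : (if (τ w').1 = (τ w).1 then
        (if (τ w).2 ∈ blackLeftSet τ (τ w).1 then
          (if (τ w').2 < (τ w).2 ∧ (τ w').2 ∉ blackLeftSet τ (τ w).1 then 1 else 0)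
          else 0) else 0) = if (τ w).1 = (τ w').1 ∧ (τ w').2 < (τ w).2 ∧
            (τ w').2 ∉ blackLeftSet τ (τ w').1 ∧ (τ w).2 ∈ blackLeftSet τ (τ w).1
          then 1 else 0 := by
    by_cases e : (τ w').1 = (τ w).1
    · simp only [e, true_and, if_true]
      rw [← ite_and]
      exact if_congr (by tauto) rfl rfl
    · simp [e, Ne.symm e]
  rw [e1, e2, ite_or_eq_add hA]

/-- In each column the inversions are the pairs of a vertex matched left and a lower one matched
right. Since the cardinalities of the left sets do not depend on the matching, only the sums of
heights vary. -/
lemma sum_inversions (h : ∀ w, Adj w (τ w)) :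
    (∑ w, ∑ w', if finProdFinEquiv w < finProdFinEquiv w' ∧
        finProdFinEquiv (τ w') < finProdFinEquiv (τ w) then 1 else 0) +
      (∑ i : Fin (k + 1), (i : ℕ).choose 2 + ∑ p : Fin k, (k - p : ℕ).choose 2) =
    ∑ i : Fin (k + 1), ∑ j ∈ leftSet τ i, (j : ℕ) +
      ∑ p : Fin k, ∑ q ∈ blackLeftSet τ p, (q : ℕ) := by
  simp_rw [ite_inversion h, Finset.sum_add_distrib]
  have hA : (∑ w : Fin (k + 1) × Fin k, ∑ w' : Fin (k + 1) × Fin k, (if w.1 = w'.1 then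
        (if w'.2 ∈ leftSet τ w'.1 then (if w.2 < w'.2 ∧ w.2 ∉ leftSet τ w'.1 then 1 else 0)
          else 0) else 0)) =
      ∑ i : Fin (k + 1), ∑ b ∈ leftSet τ i, ∑ a, if a < b ∧ a ∉ leftSet τ i then 1 else 0 := by
    rw [Finset.sum_comm, Fintype.sum_prod_type]
    refine Finset.sum_congr rfl fun i _ => ?_
    rw [← Finset.sum_filter_add_sum_filter_not Finset.univ (· ∈ leftSet τ i),
      Finset.filter_mem_eq_inter, Finset.univ_inter]
    simp only
    have hz : (∑ x ∈ Finset.univ.filter (· ∉ leftSet τ i), ∑ w : Fin (k + 1) × Fin k,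
        (if w.1 = i then (if x ∈ leftSet τ i then
          (if w.2 < x ∧ w.2 ∉ leftSet τ i then 1 else 0) else 0) else 0)) = 0 := by
      refine Finset.sum_eq_zero fun x hx => Finset.sum_eq_zero fun w _ => ?_
      simp only [Finset.mem_filter, Finset.mem_univ, true_and] at hx
      simp [hx]
    rw [hz, add_zero]
    refine Finset.sum_congr rfl fun x hx => ?_
    rw [Fintype.sum_prod_type, Finset.sum_comm]
    simp [hx]
  have hB : (∑ w : Fin (k + 1) × Fin k, ∑ w' : Fin (k + 1) × Fin k,
      (if (τ w').1 = (τ w).1 then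
        (if (τ w).2 ∈ blackLeftSet τ (τ w).1 then
          (if (τ w').2 < (τ w).2 ∧ (τ w').2 ∉ blackLeftSet τ (τ w).1 then 1 else 0)
          else 0) else 0)) =
      ∑ p : Fin k, ∑ b ∈ blackLeftSet τ p, ∑ a,
        if a < b ∧ a ∉ blackLeftSet τ p then 1 else 0 := by
    rw [Equiv.sum_comp τ (fun b => ∑ w' : Fin (k + 1) × Fin k,
      (if (τ w').1 = b.1 then
        (if b.2 ∈ blackLeftSet τ b.1 then
          (if (τ w').2 < b.2 ∧ (τ w').2 ∉ blackLeftSet τ b.1 then 1 else 0)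
          else 0) else 0))]
    have : ∀ b : Fin k × Fin (k + 1), (∑ w' : Fin (k + 1) × Fin k,
      (if (τ w').1 = b.1 then
        (if b.2 ∈ blackLeftSet τ b.1 then
          (if (τ w').2 < b.2 ∧ (τ w').2 ∉ blackLeftSet τ b.1 then 1 else 0)
          else 0) else 0)) = ∑ b' : Fin k × Fin (k + 1), (if b'.1 = b.1 then
        (if b.2 ∈ blackLeftSet τ b.1 then
          (if b'.2 < b.2 ∧ b'.2 ∉ blackLeftSet τ b.1 then 1 else 0)
          else 0) else 0) := fun b => Equiv.sum_comp τ (fun b' => (if b'.1 = b.1 then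
        (if b.2 ∈ blackLeftSet τ b.1 then
          (if b'.2 < b.2 ∧ b'.2 ∉ blackLeftSet τ b.1 then 1 else 0)
          else 0) else 0))
    simp_rw [this]
    rw [Fintype.sum_prod_type]
    refine Finset.sum_congr rfl fun i _ => ?_
    rw [← Finset.sum_filter_add_sum_filter_not Finset.univ (· ∈ blackLeftSet τ i),
      Finset.filter_mem_eq_inter, Finset.univ_inter]
    simp only
    have hz : (∑ x ∈ Finset.univ.filter (· ∉ blackLeftSet τ i), ∑ w : Fin k × Fin (k + 1),
        (if w.1 = i then (if x ∈ blackLeftSet τ i then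
          (if w.2 < x ∧ w.2 ∉ blackLeftSet τ i then 1 else 0) else 0) else 0)) = 0 := by
      refine Finset.sum_eq_zero fun x hx => Finset.sum_eq_zero fun w _ => ?_
      simp only [Finset.mem_filter, Finset.mem_univ, true_and] at hx
      simp [hx]
    rw [hz, add_zero]
    refine Finset.sum_congr rfl fun x hx => ?_
    rw [Fintype.sum_prod_type, Finset.sum_comm]
    simp [hx]
  rw [hA, hB]
  simp_rw [← sum_card_lt_notMem_add_choose, Finset.sum_add_distrib, card_leftSet h,
    card_blackLeftSet h]
  omega

/-- Each edge is counted once: by its white height if it goes left from its white end, and by its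
black height otherwise. The latter exceeds the white height by one exactly on north-east edges. -/
lemma sum_leftSet_add_sum_blackLeftSet (h : ∀ w, Adj w (τ w)) :
    ∑ i : Fin (k + 1), ∑ j ∈ leftSet τ i, (j : ℕ) +
      ∑ p : Fin k, ∑ q ∈ blackLeftSet τ p, (q : ℕ) =
    ∑ w : Fin (k + 1) × Fin k, (w.2 : ℕ) + ∑ w : Fin (k + 1) × Fin k,
      if ((τ w).1 : ℕ) = w.1 ∧ ((τ w).2 : ℕ) = w.2 + 1 then 1 else 0 := by
  simp_rw [leftSet, blackLeftSet, Finset.sum_filter]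
  rw [← Fintype.sum_prod_type (fun w : Fin (k + 1) × Fin k =>
      if ((τ (w.1, w.2)).1 : ℕ) + 1 = w.1 then (w.2 : ℕ) else 0),
    ← Fintype.sum_prod_type (fun b : Fin k × Fin (k + 1) =>
      if ((τ.symm (b.1, b.2)).1 : ℕ) = b.1 then (b.2 : ℕ) else 0), ← Equiv.sum_comp τ]
  simp only [Prod.mk.eta, Equiv.symm_apply_apply]
  rw [← Finset.sum_add_distrib, ← Finset.sum_add_distrib]
  refine Finset.sum_congr rfl fun w _ => ?_
  have := h w
  simp only [Adj] at this
  split_ifs <;> omega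

end Matching

/-- The bijection of white and black vertices respecting the column by column enumerations. -/
def columnEquiv (k : ℕ) : Fin (k + 1) × Fin k ≃ Fin k × Fin (k + 1) :=
  finProdFinEquiv.trans ((finCongr (Nat.mul_comm _ _)).trans finProdFinEquiv.symm)

/-- The sign of a perfect matching of the Aztec diamond is, up to a constant, the parity of the
number of its edges leading from a white vertex to the upper right. -/
lemma exists_sign_matching (k : ℕ) : ∃ ε : ℤ, (ε = 1 ∨ ε = -1) ∧
    ∀ τ : Fin (k + 1) × Fin k ≃ Fin k × Fin (k + 1), (∀ w, Adj w (τ w)) →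
      (Equiv.Perm.sign (τ.trans (columnEquiv k).symm) : ℤ) = ε *
        ∏ w, if ((τ w).1 : ℕ) = w.1 ∧ ((τ w).2 : ℕ) = w.2 + 1 then -1 else 1 := by
  refine ⟨(-1) ^ (∑ w : Fin (k + 1) × Fin k, (w.2 : ℕ) +
    (∑ i : Fin (k + 1), (i : ℕ).choose 2 + ∑ p : Fin k, (k - p : ℕ).choose 2)),
    neg_one_pow_eq_or ℤ _, fun τ h => ?_⟩
  have h1 := sign_eq_neg_one_pow_inversions (finProdFinEquiv (m := k + 1) (n := k))
    (finProdFinEquiv.trans (finCongr (Nat.mul_comm k (k + 1)))) τ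
  have h2 : (Equiv.Perm.sign (τ.trans (columnEquiv k).symm) : ℤ) =
      Equiv.Perm.sign ((finProdFinEquiv.symm.trans τ).trans
        (finProdFinEquiv.trans (finCongr (Nat.mul_comm k (k + 1))))) := by
    rw [← Equiv.Perm.sign_symm_trans_trans (τ.trans (columnEquiv k).symm) finProdFinEquiv]
    congr 2
    ext x
    simp [columnEquiv, Nat.mod_add_div]
  have h3 := sum_inversions h
  rw [sum_leftSet_add_sum_blackLeftSet h] at h3
  have h4 : ∏ w, (if ((τ w).1 : ℕ) = w.1 ∧ ((τ w).2 : ℕ) = w.2 + 1 then (-1 : ℤ) else 1) =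
      (-1) ^ ∑ w, if ((τ w).1 : ℕ) = w.1 ∧ ((τ w).2 : ℕ) = w.2 + 1 then 1 else 0 := by
    rw [← Finset.prod_pow_eq_pow_sum]
    refine Finset.prod_congr rfl fun w _ => ?_
    split_ifs <;> simp
  rw [h2, h1, h4, ← pow_add]
  simp only [Equiv.trans_apply, finCongr_apply, Fin.lt_def, Fin.val_cast] at h3 ⊢
  generalize (∑ i : Fin (k + 1), (i : ℕ).choose 2 + ∑ p : Fin k, (k - p : ℕ).choose 2) = C at *
  -- By `h3`, inversions plus `C` equal the sum of the white heights plus the number of north-east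
  -- edges; modulo 2 the term `C` may change sides.
  refine neg_one_pow_congr ?_
  rw [Nat.even_iff, Nat.even_iff]
  omega

/-! ### Trivializing sign functions on the lattice -/

/-- On a simply connected piece of the square lattice, a sign function on the edges with trivial
product around every face is a gauge transformation of the trivial one. Here `α x y` is the sign of
the edge from `(x, y)` to `(x + 1, y + 1)` and `β x y` is that of the edge from `(x, y + 1)` to
`(x + 1, y)`. -/
lemma exists_gauge (n : ℕ) (α β : ℕ → ℕ → ℤˣ)
    (h : ∀ x y, x + 2 ≤ n → y + 2 ≤ n → Even (x + y) →
      α x (y + 1) * β x y * β (x + 1) (y + 1) * α (x + 1) y = 1) :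
    ∃ g : ℕ → ℕ → ℤˣ,
      (∀ x y, x + 1 ≤ n → y + 1 ≤ n → Odd (x + y) → α x y = g x y * g (x + 1) (y + 1)) ∧
      (∀ x y, x + 1 ≤ n → y + 1 ≤ n → Even (x + y) → β x y = g x (y + 1) * g (x + 1) y) := by
  -- The edges between columns `0` and `1` form one zigzag path with a single vertex at each height,
  -- so the same function `g₀` of the height serves both columns. Each later column is reached along
  -- the rising edges, except for its bottom vertex, reached along a falling edge.
  let ζ : ℕ → ℤˣ := fun m => if Even m then β 0 m else α 0 m
  let g₀ : ℕ → ℤˣ := fun y => ∏ m ∈ Finset.range y, ζ m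
  let g : ℕ → ℕ → ℤˣ := fun x => Nat.rec g₀ (fun x gx => if x = 0 then g₀ else
    fun y => if y = 0 then β x 0 * gx 1 else α x (y - 1) * gx (y - 1)) x
  have g0 : g 0 = g₀ := rfl
  have g1 : g 1 = g₀ := rfl
  have gzero : ∀ x, g (x + 2) 0 = β (x + 1) 0 * g (x + 1) 1 := fun x => rfl
  have gsucc : ∀ x y, g (x + 2) (y + 1) = α (x + 1) y * g (x + 1) y := fun x y => rfl
  have sq : ∀ u : ℤˣ, u * u = 1 := Int.units_mul_self
  have main : ∀ x, (∀ y, x + 1 ≤ n → y + 1 ≤ n → Odd (x + y) →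
        α x y = g x y * g (x + 1) (y + 1)) ∧
      (∀ y, x + 1 ≤ n → y + 1 ≤ n → Even (x + y) → β x y = g x (y + 1) * g (x + 1) y) := by
    intro x
    induction x with
    | zero =>
      refine ⟨fun y _ _ hy => ?_, fun y _ _ hy => ?_⟩
      · rw [zero_add] at hy
        simp [g0, g1, g₀, Finset.prod_range_succ, ← mul_assoc, sq, ζ, Nat.not_even_iff_odd.2 hy]
      · rw [zero_add] at hy
        rw [zero_add, g0, g1]
        simp only [g₀, Finset.prod_range_succ, ζ, hy, if_true]
        rw [mul_right_comm, sq, one_mul]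
    | succ x ih =>
      refine ⟨fun y _ _ hy => ?_, fun y hx hy hxy => ?_⟩
      · rw [gsucc, mul_comm, mul_assoc, sq, mul_one]
      · cases y with
        | zero => rw [gzero, mul_left_comm, zero_add, sq, mul_one]
        | succ y =>
          have h1 := ih.1 (y + 1) (by omega) (by omega)
            (by rw [Nat.odd_iff]; rw [Nat.even_iff] at hxy; omega)
          have h2 := ih.2 y (by omega) (by omega)
            (by rw [Nat.even_iff] at *; omega)
          -- The remaining falling edges were not used to define `g`; each closes a face whose other
          -- three edges are already trivialized.
          have h3 := h x y (by omega) (by omega) (by rw [Nat.even_iff] at *; omega)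
          rw [h1, h2] at h3
          rw [gsucc]
          have e := sq (g x (y + 1))
          have e' := sq (α (x + 1) y)
          have e1 := sq (g (x + 1) y)
          have e2 := sq (g (x + 1) (y + 2))
          calc β (x + 1) (y + 1) = (g x (y + 1) * g x (y + 1)) * β (x + 1) (y + 1) *
                (α (x + 1) y * α (x + 1) y) * (g (x + 1) y * g (x + 1) y) *
                (g (x + 1) (y + 2) * g (x + 1) (y + 2)) := by rw [e, e', e1, e2]; simp
            _ = (g x (y + 1) * g (x + 1) (y + 1 + 1) * (g x (y + 1) * g (x + 1) y) *
                β (x + 1) (y + 1) * α (x + 1) y) * (g (x + 1) (y + 2) *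
                (α (x + 1) y * g (x + 1) y)) := by
              simp only [add_assoc, one_add_one_eq_two]
              ac_rfl
            _ = _ := by rw [h3, one_mul]
  exact ⟨g, fun x => (main x).1, fun x => (main x).2⟩

/-! ### Boundaries and degrees of faces -/

section Boundary

variable {k : ℕ}

lemma mem_boundary_iff (f : Pt) (u v u' v' : ℤ) :
    ((u, v), (u', v')) ∈ boundary k f ↔
      (((0 ≤ u ∧ u ≤ 2 * k) ∧ 0 ≤ v ∧ v ≤ 2 * k) ∧ (u + v) % 2 = 1) ∧
      (((0 ≤ u' ∧ u' ≤ 2 * k) ∧ 0 ≤ v' ∧ v' ≤ 2 * k) ∧ (u' + v') % 2 = 1) ∧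
      (u - u' = 1 ∨ u - u' = -1) ∧ (v - v' = 1 ∨ v - v' = -1) ∧ u % 2 = 0 ∧
      (((u + u' + (v' - v)) / 2 = f.1 ∧ (v + v' - (u' - u)) / 2 = f.2) ∨
        ((u' + u + (v - v')) / 2 = f.1 ∧ (v' + v - (u - u')) / 2 = f.2)) := by
  obtain ⟨x, y⟩ := f
  simp only [boundary, darts, vertices, rightFace, IsWhite, Finset.mem_filter, Finset.mem_product,
    Finset.mem_Icc, Int.even_iff, Int.odd_iff, Prod.swap, Prod.mk.injEq,
    abs_eq (zero_le_one (α := ℤ)), and_assoc]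

/-- White vertices lie below and above an even face, black ones to its left and right. The filters
discard those outside the square, which happens only for open faces. -/
lemma boundary_of_even {f : Pt} (hx : Even f.1) (hy : Even f.2)
    (h1 : 0 ≤ f.1 ∧ f.1 ≤ 2 * k) (h2 : 0 ≤ f.2 ∧ f.2 ≤ 2 * k) :
    boundary k f =
      ((({f.2 - 1, f.2 + 1} : Finset ℤ).filter fun v : ℤ => 0 ≤ v ∧ v ≤ 2 * (k : ℤ)) ×ˢ
        (({f.1 - 1, f.1 + 1} : Finset ℤ).filter fun u : ℤ => 0 ≤ u ∧ u ≤ 2 * (k : ℤ))).image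
        fun z => ((f.1, z.1), (z.2, f.2)) := by
  obtain ⟨x, y⟩ := f
  rw [Int.even_iff] at hx hy
  ext ⟨⟨u, v⟩, ⟨u', v'⟩⟩
  simp only [mem_boundary_iff, Finset.mem_image, Finset.mem_filter, Finset.mem_product,
    Finset.mem_insert, Finset.mem_singleton, Prod.exists, Prod.mk.injEq] at *
  constructor
  · intro h
    exact ⟨v, u', by omega⟩
  · rintro ⟨v, u, h⟩
    omega

lemma boundary_of_odd {f : Pt} (hx : Odd f.1) (hy : Odd f.2)
    (h1 : 0 < f.1 ∧ f.1 < 2 * k) (h2 : 0 < f.2 ∧ f.2 < 2 * k) :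
    boundary k f =
      (({f.1 - 1, f.1 + 1} : Finset ℤ) ×ˢ ({f.2 - 1, f.2 + 1} : Finset ℤ)).image
        fun z => ((z.1, f.2), (f.1, z.2)) := by
  obtain ⟨x, y⟩ := f
  rw [Int.odd_iff] at hx hy
  ext ⟨⟨u, v⟩, ⟨u', v'⟩⟩
  simp only [mem_boundary_iff, Finset.mem_image, Finset.mem_product,
    Finset.mem_insert, Finset.mem_singleton, Prod.exists, Prod.mk.injEq] at *
  constructor
  · intro h
    exact ⟨u, v', by omega⟩
  · rintro ⟨u, v, h⟩
    omega

lemma boundary_of_even_inner {f : Pt} (hx : Even f.1) (hy : Even f.2)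
    (h1 : 0 < f.1 ∧ f.1 < 2 * k) (h2 : 0 < f.2 ∧ f.2 < 2 * k) :
    boundary k f =
      (({f.2 - 1, f.2 + 1} : Finset ℤ) ×ˢ ({f.1 - 1, f.1 + 1} : Finset ℤ)).image
        fun z => ((f.1, z.1), (z.2, f.2)) := by
  rw [Int.even_iff] at hx hy
  rw [boundary_of_even (Int.even_iff.2 hx) (Int.even_iff.2 hy) (by omega) (by omega),
    Finset.filter_true_of_mem, Finset.filter_true_of_mem]
  · simp only [Finset.mem_insert, Finset.mem_singleton]
    omega
  · simp only [Finset.mem_insert, Finset.mem_singleton]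
    omega

lemma card_filter_neighbours {y : ℤ} (hy : Even y) (h : 0 ≤ y ∧ y ≤ 2 * k) (hk : 1 ≤ k) :
    (({y - 1, y + 1} : Finset ℤ).filter fun v : ℤ => 0 ≤ v ∧ v ≤ 2 * (k : ℤ)).card =
      if 0 < y ∧ y < 2 * k then 2 else 1 := by
  rw [Int.even_iff] at hy
  split_ifs with h1
  · rw [Finset.filter_true_of_mem, Finset.card_pair (by omega)]
    simp only [Finset.mem_insert, Finset.mem_singleton]
    omega
  · by_cases h0 : y = 0
    · have : (({y - 1, y + 1} : Finset ℤ).filter fun v : ℤ => 0 ≤ v ∧ v ≤ 2 * (k : ℤ)) = {y + 1} := by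
        ext v
        simp only [Finset.mem_filter, Finset.mem_insert, Finset.mem_singleton]
        omega
      rw [this, Finset.card_singleton]
    · have : (({y - 1, y + 1} : Finset ℤ).filter fun v : ℤ => 0 ≤ v ∧ v ≤ 2 * (k : ℤ)) = {y - 1} := by
        ext v
        simp only [Finset.mem_filter, Finset.mem_insert, Finset.mem_singleton]
        omega
      rw [this, Finset.card_singleton]

lemma faceDegree_of_even {f : Pt} (hx : Even f.1) (hy : Even f.2)
    (h1 : 0 ≤ f.1 ∧ f.1 ≤ 2 * k) (h2 : 0 ≤ f.2 ∧ f.2 ≤ 2 * k) (hk : 1 ≤ k) :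
    faceDegree k f = (if 0 < f.2 ∧ f.2 < 2 * k then 2 else 1) *
      (if 0 < f.1 ∧ f.1 < 2 * k then 2 else 1) := by
  rw [faceDegree, boundary_of_even hx hy h1 h2, Finset.card_image_of_injective,
    Finset.card_product,
    card_filter_neighbours hy h2 hk, card_filter_neighbours hx h1 hk]
  rintro ⟨a, b⟩ ⟨a', b'⟩ h
  simpa using h

lemma faceDegree_of_odd {f : Pt} (hx : Odd f.1) (hy : Odd f.2)
    (h1 : 0 < f.1 ∧ f.1 < 2 * k) (h2 : 0 < f.2 ∧ f.2 < 2 * k) : faceDegree k f = 4 := by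
  rw [faceDegree, boundary_of_odd hx hy h1 h2, Finset.card_image_of_injective,
    Finset.card_product, Finset.card_pair (by omega), Finset.card_pair (by omega)]
  rintro ⟨a, b⟩ ⟨a', b'⟩ h
  simpa using h

lemma prod_boundary_of_even {f : Pt} (hx : Even f.1) (hy : Even f.2)
    (h1 : 0 < f.1 ∧ f.1 < 2 * k) (h2 : 0 < f.2 ∧ f.2 < 2 * k) (φ : Pt × Pt → ℤ) :
    ∏ e ∈ boundary k f, φ e =
      (φ ((f.1, f.2 - 1), (f.1 - 1, f.2)) * φ ((f.1, f.2 - 1), (f.1 + 1, f.2))) *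
      (φ ((f.1, f.2 + 1), (f.1 - 1, f.2)) * φ ((f.1, f.2 + 1), (f.1 + 1, f.2))) := by
  rw [boundary_of_even_inner hx hy h1 h2, Finset.prod_image, Finset.prod_product,
    Finset.prod_pair (by omega), Finset.prod_pair (by omega), Finset.prod_pair (by omega)]
  rintro ⟨a, b⟩ - ⟨a', b'⟩ - h
  simpa using h

lemma prod_boundary_of_odd {f : Pt} (hx : Odd f.1) (hy : Odd f.2)
    (h1 : 0 < f.1 ∧ f.1 < 2 * k) (h2 : 0 < f.2 ∧ f.2 < 2 * k) (φ : Pt × Pt → ℤ) :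
    ∏ e ∈ boundary k f, φ e =
      (φ ((f.1 - 1, f.2), (f.1, f.2 - 1)) * φ ((f.1 - 1, f.2), (f.1, f.2 + 1))) *
      (φ ((f.1 + 1, f.2), (f.1, f.2 - 1)) * φ ((f.1 + 1, f.2), (f.1, f.2 + 1))) := by
  rw [boundary_of_odd hx hy h1 h2, Finset.prod_image, Finset.prod_product,
    Finset.prod_pair (by omega), Finset.prod_pair (by omega), Finset.prod_pair (by omega)]
  rintro ⟨a, b⟩ - ⟨a', b'⟩ - h
  simpa using h

end Boundary

/-! ### Kasteleyn orientations and Kasteleyn's theorem -/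

/-- The unit of `ℤ` with value `z` when `z = ±1`. -/
def toSign (z : ℤ) : ℤˣ := if z = 1 then 1 else -1

lemma coe_toSign {z : ℤ} (h : z = 1 ∨ z = -1) : (toSign z : ℤ) = z := by
  rcases h with rfl | rfl <;> simp [toSign]

section Kasteleyn

variable {k : ℕ} {φ : Pt × Pt → ℤ}

lemma IsKasteleyn.face_prod (hφ : IsKasteleyn k φ) (hk : 1 ≤ k) {f : Pt}
    (hf : f ∈ innerFaces k) : ∏ e ∈ boundary k f, φ e = -1 := by
  rw [hφ.face f hf]
  simp only [innerFaces, faces, Finset.mem_filter, Finset.mem_product, Finset.mem_Icc] at hf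
  obtain ⟨⟨h0, h⟩, h1, h2⟩ := hf
  have : faceDegree k f = 4 := by
    rcases Int.even_or_odd f.1 with hx | hx
    · have hy : Even f.2 := by
        rw [Int.even_iff] at *
        omega
      rw [faceDegree_of_even hx hy (by omega) (by omega) hk, if_pos h1, if_pos h2]
    · have hy : Odd f.2 := by
        rw [Int.even_iff] at *
        rw [Int.odd_iff] at *
        omega
      exact faceDegree_of_odd hx hy h1 h2
  rw [this]
  norm_num

lemma mem_darts_mk (k : ℕ) (u v u' v' : ℤ) : ((u, v), (u', v')) ∈ darts k ↔
      (((0 ≤ u ∧ u ≤ 2 * k) ∧ 0 ≤ v ∧ v ≤ 2 * k) ∧ (u + v) % 2 = 1) ∧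
      (((0 ≤ u' ∧ u' ≤ 2 * k) ∧ 0 ≤ v' ∧ v' ≤ 2 * k) ∧ (u' + v') % 2 = 1) ∧
      (u - u' = 1 ∨ u - u' = -1) ∧ (v - v' = 1 ∨ v - v' = -1) := by
  simp only [darts, vertices, Finset.mem_filter, Finset.mem_product,
    Finset.mem_Icc, Int.odd_iff, abs_eq (zero_le_one (α := ℤ)), and_assoc]

/-- The sign of the edge from `(x, y)` to `(x + 1, y + 1)`, relative to the reference orientation
which is `-1` on the edges leading from a white vertex to the upper right. -/
def upSign (φ : Pt × Pt → ℤ) (x y : ℕ) : ℤˣ :=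
  if Even x then -toSign (φ ((x, y), (x + 1, y + 1))) else toSign (φ ((x + 1, y + 1), (x, y)))

/-- The sign of the edge from `(x, y + 1)` to `(x + 1, y)`. -/
def downSign (φ : Pt × Pt → ℤ) (x y : ℕ) : ℤˣ :=
  if Even x then toSign (φ ((x, y + 1), (x + 1, y))) else toSign (φ ((x + 1, y), (x, y + 1)))

/-- The face product of `φ` is `-1`, and exactly one of the four edges is north-east, so the
relative signs multiply to `1`. -/
lemma IsKasteleyn.sign_face (hφ : IsKasteleyn k φ) (hk : 1 ≤ k) (x y : ℕ) (hx : x + 2 ≤ 2 * k)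
    (hy : y + 2 ≤ 2 * k) (hxy : Even (x + y)) :
    upSign φ x (y + 1) * downSign φ x y * downSign φ (x + 1) (y + 1) * upSign φ (x + 1) y = 1 := by
  have hf : ((x + 1, y + 1) : Pt) ∈ innerFaces k := by
    simp only [innerFaces, faces, Finset.mem_filter, Finset.mem_product, Finset.mem_Icc,
      Int.even_iff]
    rw [Nat.even_iff] at hxy
    omega
  have h := hφ.face_prod hk hf
  have hv : ∀ u v u' v' : ℤ, ((u, v), (u', v')) ∈ darts k →
      (toSign (φ ((u, v), (u', v'))) : ℤ) = φ ((u, v), (u', v')) :=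
    fun u v u' v' h => coe_toSign (hφ.values _ h)
  rw [Units.ext_iff]
  rcases Nat.even_or_odd x with hx0 | hx0
  · have hx1 : ¬ Even (x + 1) := by
      rw [Nat.even_iff] at *
      omega
    simp only [upSign, downSign, hx0, hx1, if_true, if_false]
    push_cast
    rw [Nat.even_iff] at *
    rw [hv, hv, hv, hv]
    · rw [prod_boundary_of_odd] at h
      · simp only [add_sub_cancel_right, add_assoc, one_add_one_eq_two] at h ⊢
        linear_combination -h
      all_goals simp only [Int.odd_iff]; omega
    all_goals rw [mem_darts_mk]; omega
  · have hx0' : ¬ Even x := by rwa [Nat.not_even_iff_odd]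
    have hx1 : Even (x + 1) := by
      rw [Nat.even_iff] at *
      omega
    simp only [upSign, downSign, hx0', hx1, if_true, if_false]
    push_cast
    rw [Nat.even_iff] at *
    rw [hv, hv, hv, hv]
    · rw [prod_boundary_of_even] at h
      · simp only [add_sub_cancel_right, add_assoc, one_add_one_eq_two] at h ⊢
        linear_combination -h
      all_goals simp only [Int.even_iff]; omega
    all_goals rw [mem_darts_mk]; omega

/-- A Kasteleyn orientation is gauge equivalent to the reference orientation. -/
lemma IsKasteleyn.exists_gauge (hφ : IsKasteleyn k φ) (hk : 1 ≤ k) :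
    ∃ (g : Fin (k + 1) × Fin k → ℤˣ) (h : Fin k × Fin (k + 1) → ℤˣ), ∀ w b, Adj w b →
      φ (whitePt w, blackPt b) =
        (if (b.1 : ℕ) = w.1 ∧ (b.2 : ℕ) = w.2 + 1 then -1 else 1) * (g w * h b : ℤˣ) := by
  obtain ⟨g, hα, hβ⟩ := AztecDimers.exists_gauge (2 * k) (upSign φ) (downSign φ)
    (fun x y hx hy hxy => hφ.sign_face hk x y hx hy hxy)
  refine ⟨fun w => g (2 * w.1) (2 * w.2 + 1), fun b => g (2 * b.1 + 1) (2 * b.2), ?_⟩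
  rintro ⟨i, j⟩ ⟨p, q⟩ hadj
  have hs := coe_toSign (hφ.values _ ((mem_darts_white_black (i, j) (p, q)).2 hadj))
  obtain ⟨h1, h2⟩ := hadj
  simp only at h1 h2
  rcases h1 with h1 | h1 <;> rcases h2 with h2 | h2
  · have := hβ (2 * i) (2 * j) (by omega) (by omega) (by rw [Nat.even_iff]; omega)
    simp only [downSign, even_two_mul, if_true] at this
    simp only [h1, h2, ← this, whitePt, blackPt] at hs ⊢
    push_cast at hs ⊢
    rw [hs]
    simp
  · have := hα (2 * i) (2 * j + 1) (by omega) (by omega) (by rw [Nat.odd_iff]; omega)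
    simp only [upSign, even_two_mul, if_true] at this
    simp only [h1, h2, whitePt, blackPt] at hs ⊢
    rw [show 2 * ((j : ℕ) + 1) = 2 * j + 1 + 1 by ring, ← this]
    push_cast at hs ⊢
    rw [show (2 * ((j : ℕ) + 1) : ℤ) = 2 * j + 1 + 1 by ring] at hs ⊢
    rw [hs]
    simp
  · have := hα (2 * p + 1) (2 * j) (by omega) (by omega) (by rw [Nat.odd_iff]; omega)
    have hne : ¬ Even (2 * (p : ℕ) + 1) := by rw [Nat.even_iff]; omega
    simp only [upSign, hne, if_false] at this
    simp only [← h1, h2, whitePt, blackPt] at hs ⊢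
    rw [show 2 * ((p : ℕ) + 1) = 2 * p + 1 + 1 by ring, mul_comm (g _ _), ← this]
    push_cast at hs ⊢
    rw [show (2 * ((p : ℕ) + 1) : ℤ) = 2 * p + 1 + 1 by ring] at hs ⊢
    rw [hs]
    simp
  · have := hβ (2 * p + 1) (2 * j + 1) (by omega) (by omega) (by rw [Nat.even_iff]; omega)
    have hne : ¬ Even (2 * (p : ℕ) + 1) := by rw [Nat.even_iff]; omega
    simp only [downSign, hne, if_false] at this
    simp only [← h1, h2, whitePt, blackPt] at hs ⊢
    rw [show 2 * ((p : ℕ) + 1) = 2 * p + 1 + 1 by ring,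
      show 2 * ((j : ℕ) + 1) = 2 * j + 1 + 1 by ring, mul_comm (g _ _), ← this]
    push_cast at hs ⊢
    rw [show (2 * ((p : ℕ) + 1) : ℤ) = 2 * p + 1 + 1 by ring,
      show (2 * ((j : ℕ) + 1) : ℤ) = 2 * j + 1 + 1 by ring] at hs ⊢
    rw [hs]
    simp

/-- Kasteleyn's theorem for the Aztec diamond. -/
lemma IsKasteleyn.exists_sign (hφ : IsKasteleyn k φ) (hk : 1 ≤ k) :
    ∃ ε : ℤ, (ε = 1 ∨ ε = -1) ∧
      ∀ τ : Fin (k + 1) × Fin k ≃ Fin k × Fin (k + 1), (∀ w, Adj w (τ w)) →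
        ∏ w, φ (whitePt w, blackPt (τ w)) =
          ε * Equiv.Perm.sign (τ.trans (columnEquiv k).symm) := by
  obtain ⟨g, h, hg⟩ := hφ.exists_gauge hk
  obtain ⟨ε, hε, hs⟩ := exists_sign_matching k
  -- A perfect matching meets every vertex once, so the gauge factors contribute the same product
  -- for every matching.
  refine ⟨ε * ((∏ w, g w) * ∏ b, h b : ℤˣ), ?_, fun τ hτ => ?_⟩
  · rcases hε with rfl | rfl <;>
      rcases Int.units_eq_one_or ((∏ w, g w) * ∏ b, h b) with h | h <;> rw [h] <;> simp
  · have he : ε * ε = 1 := by rcases hε with rfl | rfl <;> simp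
    rw [hs τ hτ, Finset.prod_congr rfl fun w _ => hg w (τ w) (hτ w), Finset.prod_mul_distrib]
    have : ∏ w, ((g w * h (τ w) : ℤˣ) : ℤ) = (((∏ w, g w) * ∏ b, h b : ℤˣ) : ℤ) := by
      rw [← Equiv.prod_comp τ h, ← Finset.prod_mul_distrib]
      push_cast
      rfl
    rw [this]
    linear_combination (-(∏ w, if ((τ w).1 : ℕ) = w.1 ∧ ((τ w).2 : ℕ) = w.2 + 1 then -1 else 1) *
      (((∏ w, g w) * ∏ b, h b : ℤˣ) : ℤ)) * he

end Kasteleyn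

/-! ### The partition function as a determinant -/

open Matrix

/-- The entries of the difference matrix: `1` on the diagonal and `-1` above it. -/
def diffEntry (m n : ℕ) : ℂ := (if m = n then 1 else 0) - if m + 1 = n then 1 else 0

/-- The Kasteleyn matrix of the Aztec diamond for oriented dimers. -/
noncomputable def dimerMatrix (k : ℕ) (a : Pt → ℂ) :
    Matrix (Fin (k + 1) × Fin k) (Fin k × Fin (k + 1)) ℂ :=
  Matrix.of fun w b => diffEntry b.1 w.1 * diffEntry w.2 b.2 *
    (a (evenFace w.1 b.2) - a (oddFace b.1 w.2))

section DimerMatrix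

variable {k : ℕ}

lemma dimerMatrix_apply_of_adj (a : Pt → ℂ) {w : Fin (k + 1) × Fin k} {b : Fin k × Fin (k + 1)}
    (h : Adj w b) :
    dimerMatrix k a w b =
      a (rightFace (whitePt w, blackPt b)) - a (rightFace (blackPt b, whitePt w)) := by
  obtain ⟨⟨i, hi⟩, ⟨j, hj⟩⟩ := w
  obtain ⟨⟨p, hp⟩, ⟨q, hq⟩⟩ := b
  obtain ⟨h1, h2⟩ := h
  simp only at h1 h2
  simp only [dimerMatrix, Matrix.of_apply, evenFace, oddFace, rightFace, whitePt, blackPt]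
  rcases h1 with rfl | rfl <;> rcases h2 with rfl | rfl
  · have e1 : ((2 * p + (2 * p + 1) + (2 * q - (2 * q + 1))) / 2 : ℤ) = 2 * p := by omega
    have e2 : ((2 * q + 1 + 2 * q - (2 * p + 1 - 2 * p)) / 2 : ℤ) = 2 * q := by omega
    have e3 : ((2 * p + 1 + 2 * p + (2 * q + 1 - 2 * q)) / 2 : ℤ) = 2 * p + 1 := by omega
    have e4 : ((2 * q + (2 * q + 1) - (2 * p - (2 * p + 1))) / 2 : ℤ) = 2 * q + 1 := by omega
    rw [e1, e2, e3, e4]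
    simp [diffEntry]
  · push_cast
    have e1 : ((2 * p + (2 * p + 1) + (2 * (j + 1) - (2 * j + 1))) / 2 : ℤ) = 2 * p + 1 := by
      omega
    have e2 : ((2 * j + 1 + 2 * (j + 1) - (2 * p + 1 - 2 * p)) / 2 : ℤ) = 2 * j + 1 := by omega
    have e3 : ((2 * p + 1 + 2 * p + (2 * j + 1 - 2 * (j + 1))) / 2 : ℤ) = 2 * p := by omega
    have e4 : ((2 * (j + 1) + (2 * j + 1) - (2 * p - (2 * p + 1))) / 2 : ℤ) = 2 * (j + 1) := by
      omega
    rw [e1, e2, e3, e4]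
    simp [diffEntry]
  · push_cast
    have e1 : ((2 * (p + 1) + (2 * p + 1) + (2 * q - (2 * q + 1))) / 2 : ℤ) = 2 * p + 1 := by
      omega
    have e2 : ((2 * q + 1 + 2 * q - (2 * p + 1 - 2 * (p + 1))) / 2 : ℤ) = 2 * q + 1 := by omega
    have e3 : ((2 * p + 1 + 2 * (p + 1) + (2 * q + 1 - 2 * q)) / 2 : ℤ) = 2 * (p + 1) := by omega
    have e4 : ((2 * q + (2 * q + 1) - (2 * (p + 1) - (2 * p + 1))) / 2 : ℤ) = 2 * q := by
      omega
    rw [e1, e2, e3, e4]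
    simp [diffEntry]
  · push_cast
    have e1 : ((2 * (p + 1) + (2 * p + 1) + (2 * (j + 1) - (2 * j + 1))) / 2 : ℤ) =
      2 * (p + 1) := by omega
    have e2 : ((2 * j + 1 + 2 * (j + 1) - (2 * p + 1 - 2 * (p + 1))) / 2 : ℤ) = 2 * (j + 1) := by
      omega
    have e3 : ((2 * p + 1 + 2 * (p + 1) + (2 * j + 1 - 2 * (j + 1))) / 2 : ℤ) = 2 * p + 1 := by
      omega
    have e4 : ((2 * (j + 1) + (2 * j + 1) - (2 * (p + 1) - (2 * p + 1))) / 2 : ℤ) =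
      2 * j + 1 := by omega
    rw [e1, e2, e3, e4]
    simp [diffEntry]

lemma dimerMatrix_apply_of_not_adj (a : Pt → ℂ) {w : Fin (k + 1) × Fin k}
    {b : Fin k × Fin (k + 1)} (h : ¬ Adj w b) : dimerMatrix k a w b = 0 := by
  simp only [Adj, not_and_or, not_or] at h
  simp only [dimerMatrix, Matrix.of_apply, diffEntry]
  rcases h with ⟨h1, h2⟩ | ⟨h1, h2⟩
  · simp [h1, h2]
  · simp [Ne.symm h1, Ne.symm h2]

/-- The partition function as a determinant. -/
lemma IsKasteleyn.exists_Z_eq_det {φ : Pt × Pt → ℤ} (hφ : IsKasteleyn k φ) (hk : 1 ≤ k) :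
    ∃ ε : ℂ, (ε = 1 ∨ ε = -1) ∧
      ∀ a, Z k a φ = ε * ((dimerMatrix k a).submatrix id (columnEquiv k)).det := by
  obtain ⟨ε, hε, hs⟩ := hφ.exists_sign hk
  refine ⟨ε, by rcases hε with rfl | rfl <;> simp, fun a => ?_⟩
  rw [Z, sum_orientedDimers, ← det_transpose, det_apply', Finset.mul_sum]
  -- Permutations of the white vertices are identified with bijections from white to black; those
  -- which are not matchings contribute zero.
  rw [← Equiv.sum_comp ((Equiv.refl (Fin (k + 1) × Fin k)).equivCongr (columnEquiv k).symm)]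
  rw [Finset.sum_filter]
  refine Finset.sum_congr rfl fun τ _ => ?_
  have hτ : ∀ w, columnEquiv k (((Equiv.refl (Fin (k + 1) × Fin k)).equivCongr
      (columnEquiv k).symm τ) w) = τ w := by
    intro w
    simp [Equiv.equivCongr]
  simp only [transpose_apply, submatrix_apply, id, hτ]
  split_ifs with h
  · have hs' := congrArg (Int.cast : ℤ → ℂ) (hs τ h)
    push_cast at hs'
    rw [← mul_assoc]
    have e : ((Equiv.refl (Fin (k + 1) × Fin k)).equivCongr (columnEquiv k).symm τ) =
        τ.trans (columnEquiv k).symm := by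
      ext w <;> simp [Equiv.equivCongr]
    rw [e, ← hs', ← Finset.prod_mul_distrib]
    refine Finset.prod_congr rfl fun w _ => ?_
    have hskew := hφ.skew _ ((mem_darts_white_black w (τ w)).2 (h w))
    simp only [Prod.swap] at hskew
    rw [hskew, dimerMatrix_apply_of_adj a (h w)]
    push_cast
    ring
  · push Not at h
    obtain ⟨w, hw⟩ := h
    rw [Finset.prod_eq_zero (Finset.mem_univ w) (dimerMatrix_apply_of_not_adj a hw)]
    simp

end DimerMatrix

/-! ### Constant odd weights: the complementary minor -/

section Uniform

variable {k : ℕ}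

lemma sum_diffEntry (j : Fin (k + 1)) :
    ∑ q : Fin (k + 1), diffEntry j q = if j = Fin.last k then 1 else 0 := by
  rw [Fin.sum_univ_eq_sum_range (fun q => diffEntry j q)]
  simp only [diffEntry, Finset.sum_sub_distrib, Finset.sum_ite_eq, Finset.mem_range, Fin.ext_iff,
    Fin.val_last]
  have := j.2
  split_ifs <;> first | omega | simp

lemma sum_diffEntry_mul_le (i i' : Fin (k + 1)) :
    ∑ p : Fin (k + 1), diffEntry p i * (if (i' : ℕ) ≤ p then 1 else 0) =
      if i = i' then 1 else 0 := by
  rw [Fin.sum_univ_eq_sum_range (fun p => diffEntry p i * (if (i' : ℕ) ≤ p then 1 else 0))]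
  simp only [diffEntry, sub_mul, Finset.sum_sub_distrib, ite_mul, one_mul, zero_mul,
    Finset.sum_ite_eq', Finset.mem_range, Fin.ext_iff, i.2, if_true]
  obtain ⟨i, hi⟩ := i
  cases i with
  | zero =>
    simp
    simp [eq_comm]
  | succ i =>
    simp only [Nat.add_right_cancel_iff, Finset.sum_ite_eq', Finset.mem_range]
    split_ifs <;> first | omega | simp

lemma det_diffEntry (n : ℕ) : (Matrix.of fun i j : Fin n => diffEntry i j).det = 1 := by
  rw [Matrix.det_of_isUpperTriangular]
  · simp [diffEntry]
  · intro i j hij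
    simp only [id, Fin.lt_def] at hij
    have h1 : (i : ℕ) ≠ j := by omega
    have h2 : (i : ℕ) + 1 ≠ j := by omega
    simp [diffEntry, h1, h2]

/-- The dimer matrix of constant odd weights, extended by one row in every column of white
vertices and by one column of black vertices. -/
def extendedMatrix (c : Fin (k + 1) → Fin (k + 1) → ℂ) :
    Matrix (Fin (k + 1) × Fin (k + 1)) (Fin (k + 1) × Fin (k + 1)) ℂ :=
  Matrix.of fun x y => diffEntry y.1 x.1 * diffEntry x.2 y.2 * c x.1 y.2

/-- With `D` the unitriangular difference matrix, the extended matrix is `(1 ⊗ D) * diagonal c * (Dᵀ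
⊗ 1)`. -/
lemma det_extendedMatrix (c : Fin (k + 1) → Fin (k + 1) → ℂ) :
    (extendedMatrix c).det = ∏ i, ∏ j, c i j := by
  have h : extendedMatrix c =
      kroneckerMap (· * ·) (1 : Matrix (Fin (k + 1)) (Fin (k + 1)) ℂ)
        (Matrix.of fun i j : Fin (k + 1) => diffEntry i j) *
      diagonal (fun x : Fin (k + 1) × Fin (k + 1) => c x.1 x.2) *
      kroneckerMap (· * ·) (Matrix.of fun i j : Fin (k + 1) => diffEntry i j)ᵀ
        (1 : Matrix (Fin (k + 1)) (Fin (k + 1)) ℂ) := by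
    ext ⟨i, j⟩ ⟨p, q⟩
    rw [mul_apply]
    simp only [extendedMatrix, of_apply, Fintype.sum_prod_type, kroneckerMap_apply,
      mul_diagonal, transpose_apply, one_apply]
    rw [Finset.sum_eq_single i, Finset.sum_eq_single q]
    · simp
      ring
    · intro x _ hx
      simp [hx]
    · simp
    · intro x _ hx
      refine Finset.sum_eq_zero fun y _ => ?_
      simp [hx.symm]
    · simp
  rw [h, det_mul, det_mul, det_kronecker, det_kronecker, det_transpose, det_diffEntry, det_one,
    det_diagonal, Fintype.prod_prod_type]
  simp

/-- This exhibits the columns of the inverse belonging to the additional rows. Differencing the step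
function in `p` singles out `i = i'`, where the weights cancel; the row sums of `D` then vanish
except in the last row. -/
lemma extendedMatrix_mul_apply (c : Fin (k + 1) → Fin (k + 1) → ℂ) (hc : ∀ i j, c i j ≠ 0)
    (x : Fin (k + 1) × Fin (k + 1)) (i' : Fin (k + 1)) :
    ∑ y, extendedMatrix c x y * ((if (i' : ℕ) ≤ y.1 then 1 else 0) * (1 / c i' y.2)) =
      if x = (i', Fin.last k) then 1 else 0 := by
  obtain ⟨i, j⟩ := x
  have : ∀ p q : Fin (k + 1), extendedMatrix c (i, j) (p, q) *
      ((if (i' : ℕ) ≤ p then 1 else 0) * (1 / c i' q)) =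
      (diffEntry p i * (if (i' : ℕ) ≤ p then 1 else 0)) *
        (diffEntry j q * (c i q / c i' q)) := by
    intro p q
    simp only [extendedMatrix, of_apply]
    ring
  rw [Fintype.sum_prod_type]
  simp only [this]
  simp_rw [← Finset.mul_sum]
  rw [← Finset.sum_mul, sum_diffEntry_mul_le]
  by_cases h : i = i'
  · subst h
    simp [hc, sum_diffEntry]
  · simp [h]

/-- The rows of the extended matrix: those of the dimer matrix and the additional ones. -/
noncomputable def rowEquiv (k : ℕ) :
    (Fin (k + 1) × Fin k) ⊕ Fin (k + 1) ≃ Fin (k + 1) × Fin (k + 1) :=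
  Equiv.ofBijective (Sum.elim (fun w => (w.1, w.2.castSucc)) fun i => (i, Fin.last k)) <| by
    rw [Fintype.bijective_iff_injective_and_card]
    constructor
    · rintro (⟨i, j⟩ | i) (⟨i', j'⟩ | i') h <;>
        simp only [Sum.elim_inl, Sum.elim_inr, Prod.mk.injEq, Fin.ext_iff, Fin.val_castSucc,
          Fin.val_last, Sum.inl.injEq, Sum.inr.injEq, reduceCtorEq] at h ⊢ <;> omega
    · simp
      ring

/-- The columns of the extended matrix: those of the dimer matrix and the additional ones. -/
noncomputable def colEquiv (k : ℕ) :
    (Fin (k + 1) × Fin k) ⊕ Fin (k + 1) ≃ Fin (k + 1) × Fin (k + 1) :=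
  Equiv.ofBijective (Sum.elim
    (fun w => ((columnEquiv k w).1.castSucc, (columnEquiv k w).2)) fun q => (Fin.last k, q)) <| by
    rw [Fintype.bijective_iff_injective_and_card]
    constructor
    · rintro (w | q) (w' | q') h <;>
        simp only [Sum.elim_inl, Sum.elim_inr, Prod.mk.injEq, Fin.ext_iff, Fin.val_castSucc,
          Fin.val_last, Sum.inl.injEq, Sum.inr.injEq, reduceCtorEq] at h ⊢
      · rw [← (columnEquiv k).injective.eq_iff]
        exact Prod.ext (Fin.ext h.1) (Fin.ext h.2)
      · omega
      · omega
      · exact h.2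
    · simp
      ring

/-- The block form of Jacobi's identity. At `p = k` the step function is `1`, so the additional
entries of the inverse columns form the transpose of `(1 / c i j)`. The blocks `G` and `X` disappear
on taking determinants. -/
lemma extendedMatrix_mul_fromBlocks (c : Fin (k + 1) → Fin (k + 1) → ℂ)
    (hc : ∀ i j, c i j ≠ 0) :
    ∃ (G : Matrix (Fin (k + 1) × Fin k) (Fin (k + 1)) ℂ)
      (X : Matrix (Fin (k + 1)) (Fin (k + 1) × Fin k) ℂ),
      (extendedMatrix c).submatrix (rowEquiv k) (colEquiv k) *
        fromBlocks 1 G 0 (Matrix.of fun i j => 1 / c i j)ᵀ =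
      fromBlocks ((Matrix.of fun (w : Fin (k + 1) × Fin k) (b : Fin k × Fin (k + 1)) =>
        diffEntry b.1 w.1 * diffEntry w.2 b.2 * c w.1 b.2).submatrix id (columnEquiv k)) 0 X 1 := by
  let g : Fin (k + 1) × Fin (k + 1) → Fin (k + 1) → ℂ := fun y i' =>
    (if (i' : ℕ) ≤ y.1 then 1 else 0) * (1 / c i' y.2)
  refine ⟨Matrix.of fun w i' => g (colEquiv k (Sum.inl w)) i',
    Matrix.of fun i w => extendedMatrix c (rowEquiv k (Sum.inr i)) (colEquiv k (Sum.inl w)), ?_⟩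
  have hcol : ∀ x i', ∑ y, extendedMatrix c x (colEquiv k y) * g (colEquiv k y) i' =
      if x = (i', Fin.last k) then 1 else 0 := by
    intro x i'
    rw [Equiv.sum_comp (colEquiv k) (fun y => extendedMatrix c x y * g y i')]
    exact extendedMatrix_mul_apply c hc x i'
  have hlast : ∀ q i', g (colEquiv k (Sum.inr q)) i' = 1 / c i' q := by
    intro q i'
    simp [g, colEquiv, (Fin.le_last i').not_gt]
  have hr : ∀ (x : (Fin (k + 1) × Fin k) ⊕ Fin (k + 1)) (i' : Fin (k + 1)),
      ((extendedMatrix c).submatrix (rowEquiv k) (colEquiv k) * fromBlocks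
        (1 : Matrix (Fin (k + 1) × Fin k) (Fin (k + 1) × Fin k) ℂ)
        (Matrix.of fun w i' => g (colEquiv k (Sum.inl w)) i') 0
        (Matrix.of fun i j => 1 / c i j)ᵀ) x (Sum.inr i') =
      if rowEquiv k x = (i', Fin.last k) then 1 else 0 := by
    intro x i'
    rw [← hcol, mul_apply, Fintype.sum_sum_type, Fintype.sum_sum_type]
    simp [hlast]
  have hl : ∀ (x : (Fin (k + 1) × Fin k) ⊕ Fin (k + 1)) (w : Fin (k + 1) × Fin k),
      ((extendedMatrix c).submatrix (rowEquiv k) (colEquiv k) * fromBlocks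
        (1 : Matrix (Fin (k + 1) × Fin k) (Fin (k + 1) × Fin k) ℂ)
        (Matrix.of fun w i' => g (colEquiv k (Sum.inl w)) i') 0
        (Matrix.of fun i j => 1 / c i j)ᵀ) x (Sum.inl w) =
      extendedMatrix c (rowEquiv k x) (colEquiv k (Sum.inl w)) := by
    intro x w
    rw [mul_apply, Fintype.sum_sum_type]
    simp [one_apply]
  ext x y
  rcases y with w | i'
  · rw [hl]
    rcases x with x | x
    · simp [extendedMatrix, rowEquiv, colEquiv]
    · simp
  · rw [hr]
    rcases x with x | x
    · simp [rowEquiv, Fin.castSucc_ne_last]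
    · simp [rowEquiv, one_apply]

lemma exists_det_uniform (k : ℕ) : ∃ η : ℂ, (η = 1 ∨ η = -1) ∧
    ∀ c : Fin (k + 1) → Fin (k + 1) → ℂ, (∀ i j, c i j ≠ 0) →
      ((Matrix.of fun (w : Fin (k + 1) × Fin k) (b : Fin k × Fin (k + 1)) =>
        diffEntry b.1 w.1 * diffEntry w.2 b.2 * c w.1 b.2).submatrix id (columnEquiv k)).det =
      η * (∏ i, ∏ j, c i j) * (Matrix.of fun i j => 1 / c i j).det := by
  refine ⟨((Equiv.Perm.sign ((rowEquiv k).symm.trans (colEquiv k)) : ℤ) : ℂ), ?_, fun c hc => ?_⟩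
  · rcases Int.units_eq_one_or (Equiv.Perm.sign ((rowEquiv k).symm.trans (colEquiv k))) with h | h
      <;> simp [h]
  · obtain ⟨G, X, h⟩ := extendedMatrix_mul_fromBlocks c hc
    have h' := congrArg det h
    rw [det_mul, det_fromBlocks_zero₂₁, det_fromBlocks_zero₁₂, det_one, one_mul, det_one,
      mul_one, det_transpose] at h'
    rw [← h', ← det_extendedMatrix, ← det_permute', ← det_submatrix_equiv_self (rowEquiv k)
      (submatrix _ _ _), submatrix_submatrix]
    congr 3
    ext x <;> simp

lemma IsKasteleyn.exists_Z_eq_uniform {φ : Pt × Pt → ℤ} (hφ : IsKasteleyn k φ) (hk : 1 ≤ k) :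
    ∃ ε : ℂ, (ε = 1 ∨ ε = -1) ∧
      ∀ (a : Pt → ℂ) (c : Matrix (Fin (k + 1)) (Fin (k + 1)) ℂ) (d : ℂ),
        (∀ i j : Fin (k + 1), a (evenFace i j) = c i j) →
        (∀ i j : Fin k, a (oddFace i j) = d) →
        (∀ i j, c i j ≠ d) →
        Z k a φ = ε * (∏ i, ∏ j, (c i j - d)) * (Matrix.of fun i j => 1 / (c i j - d)).det := by
  obtain ⟨ε, hε, hZ⟩ := hφ.exists_Z_eq_det hk
  obtain ⟨η, hη, hdet⟩ := exists_det_uniform k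
  refine ⟨ε * η, ?_, fun a c d hc hd hne => ?_⟩
  · rcases hε with rfl | rfl <;> rcases hη with rfl | rfl <;> simp
  · have := hdet (fun i j => c i j - d) fun i j => sub_ne_zero.2 (hne i j)
    simp only [hZ a, dimerMatrix, hc, hd]
    rw [this]
    ring

end Uniform

/-! ### The normalization is the product of all face weights -/

section Normalization

variable {k : ℕ}

lemma card_vertices (k : ℕ) : (vertices k).card = 2 * (k * (k + 1)) := by
  classical
  have h : vertices k = (Finset.univ.image (whitePt (k := k))) ∪
      (Finset.univ.image (blackPt (k := k))) := by
    ext v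
    simp only [mem_vertices_iff, Finset.mem_union, Finset.mem_image, Finset.mem_univ, true_and,
      eq_comm]
  rw [h, Finset.card_union_of_disjoint, Finset.card_image_of_injective _ whitePt_injective,
    Finset.card_image_of_injective _ blackPt_injective]
  · simp
    ring
  · rw [Finset.disjoint_left]
    simp only [Finset.mem_image, Finset.mem_univ, true_and]
    rintro _ ⟨w, rfl⟩ ⟨b, hb⟩
    exact whitePt_ne_blackPt w b hb.symm

lemma evenFace_mem (i j : Fin (k + 1)) : evenFace i j ∈ faces k := by
  simp only [faces, evenFace, Finset.mem_filter, Finset.mem_product, Finset.mem_Icc, Int.even_iff]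
  omega

lemma oddFace_mem (i j : Fin k) : oddFace i j ∈ faces k := by
  simp only [faces, oddFace, Finset.mem_filter, Finset.mem_product, Finset.mem_Icc, Int.even_iff]
  omega

lemma mem_faces_iff (f : Pt) : f ∈ faces k ↔
    (∃ x : Fin (k + 1) × Fin (k + 1), f = evenFace x.1 x.2) ∨
      ∃ x : Fin k × Fin k, f = oddFace x.1 x.2 := by
  constructor
  · obtain ⟨x, y⟩ := f
    intro h
    simp only [faces, Finset.mem_filter, Finset.mem_product, Finset.mem_Icc, Int.even_iff] at h
    rcases Int.even_or_odd' x with ⟨i, hi | hi⟩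
    · left
      refine ⟨(⟨i.toNat, by omega⟩, ⟨(y / 2).toNat, by omega⟩), ?_⟩
      simp only [evenFace, Prod.mk.injEq]
      omega
    · right
      refine ⟨(⟨i.toNat, by omega⟩, ⟨(y / 2).toNat, by omega⟩), ?_⟩
      simp only [oddFace, Prod.mk.injEq]
      omega
  · rintro (⟨x, rfl⟩ | ⟨x, rfl⟩)
    exacts [evenFace_mem _ _, oddFace_mem _ _]

lemma prod_faces (g : Pt → ℂ) : ∏ f ∈ faces k, g f =
    (∏ i : Fin (k + 1), ∏ j : Fin (k + 1), g (evenFace i j)) *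
      ∏ i : Fin k, ∏ j : Fin k, g (oddFace i j) := by
  classical
  have h : faces k = (Finset.univ.image fun x : Fin (k + 1) × Fin (k + 1) => evenFace x.1 x.2) ∪
      (Finset.univ.image fun x : Fin k × Fin k => oddFace x.1 x.2) := by
    ext v
    simp only [mem_faces_iff, Finset.mem_union, Finset.mem_image, Finset.mem_univ, true_and,
      eq_comm]
  rw [h, Finset.prod_union, Finset.prod_image, Finset.prod_image, Fintype.prod_prod_type,
    Fintype.prod_prod_type]
  · rintro ⟨i, j⟩ - ⟨i', j'⟩ - h
    simp only [oddFace, Prod.mk.injEq] at h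
    exact Prod.ext (Fin.ext (by simp; omega)) (Fin.ext (by simp; omega))
  · rintro ⟨i, j⟩ - ⟨i', j'⟩ - h
    simp only [evenFace, Prod.mk.injEq] at h
    exact Prod.ext (Fin.ext (by simp; omega)) (Fin.ext (by simp; omega))
  · rw [Finset.disjoint_left]
    simp only [Finset.mem_image, Finset.mem_univ, true_and]
    rintro _ ⟨w, rfl⟩ ⟨b, hb⟩
    simp only [evenFace, oddFace, Prod.mk.injEq] at hb
    omega

lemma faceDegree_of_mem_innerFaces (hk : 1 ≤ k) {f : Pt} (hf : f ∈ innerFaces k) :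
    faceDegree k f = 4 := by
  simp only [innerFaces, Finset.mem_filter] at hf
  obtain ⟨hf, h1, h2⟩ := hf
  rcases (mem_faces_iff f).1 hf with ⟨x, rfl⟩ | ⟨x, rfl⟩
  · rw [faceDegree_of_even (by simp [evenFace]) (by simp [evenFace]) (by omega) (by omega) hk,
      if_pos h1, if_pos h2]
  · exact faceDegree_of_odd (by simp [oddFace]) (by simp [oddFace]) h1 h2

lemma faceDegree_of_mem_openFaces (hk : 1 ≤ k) {f : Pt} (hf : f ∈ openFaces k) :
    (faceDegree k f + 1) / 2 = 1 := by
  simp only [openFaces, innerFaces, Finset.mem_sdiff, Finset.mem_filter, not_and] at hf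
  obtain ⟨hf, h⟩ := hf
  have h := h hf
  rcases (mem_faces_iff f).1 hf with ⟨x, rfl⟩ | ⟨x, rfl⟩
  · simp only [faces, Finset.mem_filter, Finset.mem_product, Finset.mem_Icc] at hf
    rw [faceDegree_of_even (by simp [evenFace]) (by simp [evenFace]) hf.1.1 hf.1.2 hk]
    split_ifs with h2 h1
    · exact absurd h2.2 (h h1 h2.1)
    all_goals norm_num
  · simp only [oddFace] at h
    omega

/-- The number of vertices `2 k (k + 1)` is divisible by 4. Inner faces have degree 4 and open ones
degree 1 or 2, so every exponent is 1. -/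
lemma normalization_eq_prod (hk : 1 ≤ k) (a : Pt → ℂ) :
    normalization k a = ∏ f ∈ faces k, a f := by
  have h1 : Complex.I ^ (vertices k).card = 1 := by
    obtain ⟨m, hm⟩ := Nat.even_mul_succ_self k
    rw [card_vertices, hm, show 2 * (m + m) = 4 * m by ring, pow_mul, Complex.I_pow_four, one_pow]
  have hsub : innerFaces k ⊆ faces k := Finset.filter_subset _ _
  rw [normalization, h1, one_mul, ← Finset.prod_sdiff hsub, mul_comm]
  congr 1
  · refine Finset.prod_congr rfl fun f hf => ?_
    rw [faceDegree_of_mem_openFaces hk hf, pow_one]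
  · refine Finset.prod_congr rfl fun f hf => ?_
    rw [faceDegree_of_mem_innerFaces hk hf]
    norm_num

end Normalization

/-! ### The ratio at finite nonzero weights -/

lemma det_add_const {n : ℕ} (N : Matrix (Fin n) (Fin n) ℂ) (hN : N.det ≠ 0) (x : ℂ) :
    (Matrix.of fun i j => N i j + x).det = N.det * (1 + x * ∑ i, ∑ j, N⁻¹ i j) := by
  have h : (Matrix.of fun i j => N i j + x) =
      N + replicateCol Unit (fun _ : Fin n => x) * replicateRow Unit fun _ : Fin n => (1 : ℂ) := by
    ext i j
    simp [mul_apply]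
  rw [h, det_add_replicateCol_mul_replicateRow (isUnit_iff_ne_zero.2 hN)]
  congr 1
  rw [det_unique]
  simp only [Matrix.add_apply, mul_apply, replicateRow_apply, replicateCol_apply, one_apply, one_mul,
    if_true]
  rw [Finset.sum_comm (f := fun i j => N⁻¹ i j), ← mul_comm (∑ _, _), Finset.sum_mul]

/-- The three powers of `d` in the ratio come from the odd faces, from the factors of `∏ (c⁻¹ -
d⁻¹)`, and from the scalar `-d²` in a determinant of size `k + 1`. -/
lemma inv_pow_parity (k : ℕ) {d : ℂ} (hd : d ≠ 0) :
    d ^ (k * k) * (-d⁻¹) ^ ((k + 1) * (k + 1)) * (-d ^ 2) ^ (k + 1) = d := by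
  have he : Even ((k + 1) * (k + 1) + (k + 1)) := by
    have := Nat.even_mul_succ_self (k + 1)
    rwa [show (k + 1) * (k + 1 + 1) = (k + 1) * (k + 1) + (k + 1) by ring] at this
  rw [neg_pow, neg_pow (d ^ 2)]
  calc _ = (-1) ^ ((k + 1) * (k + 1) + (k + 1)) * (d ^ (k * k) * (d ^ 2) ^ (k + 1)) *
        (d⁻¹) ^ ((k + 1) * (k + 1)) := by ring
    _ = d * d ^ ((k + 1) * (k + 1)) * (d⁻¹) ^ ((k + 1) * (k + 1)) := by
      rw [he.neg_one_pow]
      ring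
    _ = d := by rw [mul_assoc, ← mul_pow, mul_inv_cancel₀ hd, one_pow, mul_one]

lemma IsKasteleyn.ratio_eq {k : ℕ} {φ : Pt × Pt → ℤ} (hφ : IsKasteleyn k φ) (hk : 1 ≤ k)
    (a : Pt → ℂ) (c : Matrix (Fin (k + 1)) (Fin (k + 1)) ℂ) (d : ℂ)
    (N : Matrix (Fin (k + 1)) (Fin (k + 1)) ℂ)
    (hc : ∀ i j : Fin (k + 1), a (evenFace i j) = c i j)
    (hd : ∀ i j : Fin k, a (oddFace i j) = d) (hne : ∀ i j, c i j ≠ d)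
    (hN : ∀ i j, N i j = 1 / (c i j - d)) (ha : ∀ f ∈ faces k, a f ≠ 0) (hdet : N.det ≠ 0) :
    Z k a φ ≠ 0 ∧ Y k a φ = d + ∑ i, ∑ j, N⁻¹ i j := by
  obtain ⟨ε, hε, hZ⟩ := hφ.exists_Z_eq_uniform hk
  have hε0 : ε ≠ 0 := by rcases hε with rfl | rfl <;> simp
  have hN' : (Matrix.of fun i j => 1 / (c i j - d)) = N := by
    ext i j
    exact (hN i j).symm
  have hP0 : ∏ i, ∏ j, (c i j - d) ≠ 0 :=
    Finset.prod_ne_zero_iff.2 fun i _ => Finset.prod_ne_zero_iff.2 fun j _ =>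
      sub_ne_zero.2 (hne i j)
  have hZa := hZ a c d hc hd hne
  rw [hN'] at hZa
  have hc0 : ∀ i j, c i j ≠ 0 := fun i j => hc i j ▸ ha _ (evenFace_mem i j)
  have hd0 : d ≠ 0 := hd ⟨0, hk⟩ ⟨0, hk⟩ ▸ ha _ (oddFace_mem _ _)
  have hZ0 : Z k a φ ≠ 0 := by
    rw [hZa]
    exact mul_ne_zero (mul_ne_zero hε0 hP0) hdet
  refine ⟨hZ0, ?_⟩
  have hZi := hZ (fun f => (a f)⁻¹) (Matrix.of fun i j => (c i j)⁻¹) d⁻¹ (by simp [hc])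
    (by simp [hd]) (fun i j => by simpa using hne i j)
  -- Entrywise, `1 / (c⁻¹ - d⁻¹) = -c d / (c - d) = -d² (1 / (c - d) + d⁻¹)`.
  have hNi : (Matrix.of fun i j => 1 / ((Matrix.of fun i j => (c i j)⁻¹) i j - d⁻¹)) =
      (-d ^ 2) • (Matrix.of fun i j => N i j + d⁻¹) := by
    ext i j
    have h1 := hc0 i j
    have h2 := sub_ne_zero.2 (hne i j)
    have h3 := sub_ne_zero.2 (hne i j).symm
    simp only [of_apply, Matrix.smul_apply, hN, smul_eq_mul]
    have h4 : (c i j)⁻¹ - d⁻¹ = (d - c i j) / (c i j * d) := by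
      field_simp
    rw [h4, one_div_div, div_eq_iff h3]
    field_simp
    ring
  have hPi : ∏ i, ∏ j, ((Matrix.of fun i j => (c i j)⁻¹) i j - d⁻¹) =
      (∏ i, ∏ j, (c i j - d)) * (-d⁻¹) ^ ((k + 1) * (k + 1)) * (∏ i, ∏ j, c i j)⁻¹ := by
    have h : ∀ i j, (Matrix.of fun i j => (c i j)⁻¹) i j - d⁻¹ =
        (c i j - d) * (-d⁻¹) * (c i j)⁻¹ := by
      intro i j
      have h1 := hc0 i j
      simp only [of_apply]
      field_simp
      ring
    simp only [h, Finset.prod_mul_distrib, Finset.prod_const, Finset.card_univ, Fintype.card_fin,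
      Finset.prod_inv_distrib, ← pow_mul]
  have hC0 : ∏ i, ∏ j, c i j ≠ 0 :=
    Finset.prod_ne_zero_iff.2 fun i _ => Finset.prod_ne_zero_iff.2 fun j _ => hc0 i j
  rw [hNi, hPi, det_smul, Fintype.card_fin, det_add_const N hdet] at hZi
  rw [Y, normalization_eq_prod hk, prod_faces, hZi, hZa]
  simp only [hc, hd, Finset.prod_const, Finset.card_univ, Fintype.card_fin, ← pow_mul]
  have key := inv_pow_parity k hd0
  generalize (∑ i, ∑ j, N⁻¹ i j) = S at *
  generalize (∏ i, ∏ j, (c i j - d)) = P at *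
  generalize (∏ i, ∏ j, c i j) = C at *
  calc _ = (d ^ (k * k) * (-d⁻¹) ^ ((k + 1) * (k + 1)) * (-d ^ 2) ^ (k + 1)) * (1 + d⁻¹ * S) *
        ((C * C⁻¹) * ((ε * P * N.det) / (ε * P * N.det))) := by ring
    _ = d * (1 + d⁻¹ * S) := by
      rw [key, mul_inv_cancel₀ hC0, div_self (mul_ne_zero (mul_ne_zero hε0 hP0) hdet), one_mul,
        mul_one]
    _ = d + S := by rw [mul_add, mul_one, mul_inv_cancel_left₀ hd0]

/-! ### Homogeneous coordinates for the face weights -/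

/-- Indices of the faces of the Aztec diamond: the even ones and the odd ones. -/
abbrev FaceIndex (k : ℕ) : Type := (Fin (k + 1) × Fin (k + 1)) ⊕ (Fin k × Fin k)

/-- The face with a given index. -/
def facePt {k : ℕ} : FaceIndex k → Pt :=
  Sum.elim (fun x => evenFace x.1 x.2) fun x => oddFace x.1 x.2

/-- The dimer matrix is `whiteFace * diagonal a * faceBlack`. -/
def whiteFace (k : ℕ) : Matrix (Fin (k + 1) × Fin k) (FaceIndex k) ℂ :=
  Matrix.of fun w => Sum.elim (fun x => if w.1 = x.1 then diffEntry w.2 x.2 else 0)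
    fun x => if w.2 = x.2 then -diffEntry x.1 w.1 else 0

/-- See `whiteFace`. -/
def faceBlack (k : ℕ) : Matrix (FaceIndex k) (Fin k × Fin (k + 1)) ℂ :=
  Matrix.of fun x b => Sum.elim (fun x : Fin (k + 1) × Fin (k + 1) =>
      if x.2 = b.2 then diffEntry b.1 x.1 else 0)
    (fun x : Fin k × Fin k => if x.1 = b.1 then diffEntry x.2 b.2 else 0) x

/-- The homogeneous form of the partition function, at face weights `s / t`. -/
noncomputable def homogeneousZ (k : ℕ) (s t : FaceIndex k → ℂ) : ℂ :=
  (fromBlocks (diagonal t) (-(faceBlack k).submatrix id (columnEquiv k))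
    (whiteFace k * diagonal s) 0).det

section Homogeneous

variable {k : ℕ}

lemma dimerMatrix_eq_mul (a : Pt → ℂ) :
    dimerMatrix k a = whiteFace k * diagonal (fun x : FaceIndex k => a (facePt x)) * faceBlack k := by
  ext w b
  rw [mul_apply, Fintype.sum_sum_type]
  simp only [mul_diagonal, whiteFace, faceBlack, of_apply, Sum.elim_inl, Sum.elim_inr, facePt,
    Fintype.sum_prod_type, dimerMatrix]
  have h1 : ∑ i : Fin (k + 1), ∑ q : Fin (k + 1), (if w.1 = i then diffEntry w.2 q else 0) *
      a (evenFace i q) * (if q = b.2 then diffEntry b.1 i else 0) =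
      diffEntry w.2 b.2 * a (evenFace w.1 b.2) * diffEntry b.1 w.1 := by
    simp
  have h2 : ∑ p : Fin k, ∑ j : Fin k, (if w.2 = j then -diffEntry p w.1 else 0) *
      a (oddFace p j) * (if p = b.1 then diffEntry j b.2 else 0) =
      -diffEntry b.1 w.1 * a (oddFace b.1 w.2) * diffEntry w.2 b.2 := by
    simp
  rw [h1, h2]
  ring

/-- The Schur complement of `diagonal t` is `whiteFace * diagonal (s / t) * faceBlack`. The block
determinant itself involves no division, so it still makes sense at `t = 0`, that is, at infinite
weights. -/
lemma homogeneousZ_eq {s t : FaceIndex k → ℂ} {a : Pt → ℂ} (ht : ∀ x, t x ≠ 0)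
    (h : ∀ x, a (facePt x) * t x = s x) :
    homogeneousZ k s t =
      (∏ x, t x) * ((dimerMatrix k a).submatrix id (columnEquiv k)).det := by
  have hi : diagonal t * diagonal (fun x => (t x)⁻¹) = 1 := by
    rw [diagonal_mul_diagonal, ← diagonal_one]
    congr 1
    ext x
    exact mul_inv_cancel₀ (ht x)
  let _ : Invertible (diagonal t) := invertibleOfRightInverse _ _ hi
  have hinv : ⅟(diagonal t) = diagonal (fun x => (t x)⁻¹) := rfl
  rw [homogeneousZ, det_fromBlocks₁₁, det_diagonal, hinv, dimerMatrix_eq_mul]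
  congr 2
  have hst : (fun x => s x * (t x)⁻¹) = fun x => a (facePt x) := by
    ext x
    rw [← h x, mul_inv_cancel_right₀ (ht x)]
  rw [Matrix.mul_assoc (whiteFace k), diagonal_mul_diagonal, hst, zero_sub, Matrix.mul_neg, neg_neg]
  rfl

lemma continuous_homogeneousZ (k : ℕ) :
    Continuous fun x : (FaceIndex k → ℂ) × (FaceIndex k → ℂ) => homogeneousZ k x.1 x.2 := by
  unfold homogeneousZ
  refine Continuous.matrix_det (Continuous.matrix_fromBlocks ?_ ?_ ?_ ?_)
  · exact continuous_snd.matrix_diagonal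
  · exact continuous_const
  · exact continuous_const.matrix_mul continuous_fst.matrix_diagonal
  · exact continuous_const

lemma prod_faces_eq (g : Pt → ℂ) : ∏ f ∈ faces k, g f = ∏ x : FaceIndex k, g (facePt x) := by
  rw [prod_faces, Fintype.prod_sum_type, Fintype.prod_prod_type, Fintype.prod_prod_type]
  rfl

lemma facePt_mem (x : FaceIndex k) : facePt x ∈ faces k := by
  rcases x with x | x
  exacts [evenFace_mem _ _, oddFace_mem _ _]

/-- Inverting the weights exchanges `s` and `t`, and the normalization `∏ s / t` is exactly the
quotient of the two cleared denominators. -/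
lemma IsKasteleyn.Y_eq_homogeneous {φ : Pt × Pt → ℤ} (hφ : IsKasteleyn k φ) (hk : 1 ≤ k)
    {b : Pt → ℂ} (hb : b ∈ regularWeights k φ) {s t : FaceIndex k → ℂ} (ht : ∀ x, t x ≠ 0)
    (h : ∀ x, b (facePt x) * t x = s x) :
    Y k b φ = homogeneousZ k t s / homogeneousZ k s t := by
  obtain ⟨ε, hε, hZ⟩ := hφ.exists_Z_eq_det hk
  have hε0 : ε ≠ 0 := by rcases hε with rfl | rfl <;> simp
  have hb0 : ∀ x, b (facePt x) ≠ 0 := fun x => hb.1 _ (facePt_mem x)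
  have hs : ∀ x, s x ≠ 0 := fun x => h x ▸ mul_ne_zero (hb0 x) (ht x)
  have e1 := homogeneousZ_eq ht h
  have e2 := homogeneousZ_eq (a := fun f => (b f)⁻¹) hs (fun x => by
    rw [← h x, inv_mul_cancel_left₀ (hb0 x)] : ∀ x, (b (facePt x))⁻¹ * s x = t x)
  have hst : ∏ x, s x = (∏ x : FaceIndex k, b (facePt x)) * ∏ x, t x := by
    rw [← Finset.prod_mul_distrib]
    exact Finset.prod_congr rfl fun x _ => (h x).symm
  have ht0 : ∏ x, t x ≠ 0 := Finset.prod_ne_zero_iff.2 fun x _ => ht x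
  have hD := hb.2
  rw [hZ] at hD
  have hD := right_ne_zero_of_mul hD
  rw [Y, normalization_eq_prod hk, prod_faces_eq, hZ, hZ, e1, e2, hst]
  field_simp

end Homogeneous

/-! ### Charts of the Riemann sphere and approximating curves -/

/-- The numerator of a complex number in the affine chart around a point of the sphere. -/
noncomputable def chartNum (p : OnePoint ℂ) (b : ℂ) : ℂ := p.elim 1 fun _ => b

/-- The denominator of a complex number in the affine chart around a point of the sphere. -/
noncomputable def chartDen (p : OnePoint ℂ) (b : ℂ) : ℂ := p.elim b⁻¹ fun _ => 1

/-- The numerator of the centre of the chart. -/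
noncomputable def centreNum (p : OnePoint ℂ) : ℂ := p.elim 1 id

/-- The denominator of the centre of the chart. -/
noncomputable def centreDen (p : OnePoint ℂ) : ℂ := p.elim 0 fun _ => 1

/-- A punctured curve of complex numbers with limit `p`. -/
noncomputable def pathTo (p : OnePoint ℂ) (z : ℂ) : ℂ := p.elim z⁻¹ fun x => x + z

section Chart

lemma tendsto_chartNum (p : OnePoint ℂ) :
    Tendsto (chartNum p) (comap (↑) (𝓝 p)) (𝓝 (centreNum p)) := by
  induction p using OnePoint.rec with
  | infty => exact tendsto_const_nhds
  | coe x =>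
    rw [OnePoint.comap_coe_nhds]
    exact tendsto_id

lemma tendsto_chartDen (p : OnePoint ℂ) :
    Tendsto (chartDen p) (comap (↑) (𝓝 p)) (𝓝 (centreDen p)) := by
  induction p using OnePoint.rec with
  | infty =>
    rw [OnePoint.comap_coe_nhds_infty, coclosedCompact_eq_cocompact,
      ← Metric.cobounded_eq_cocompact]
    exact tendsto_inv₀_cobounded
  | coe x => exact tendsto_const_nhds

lemma mul_chartDen (p : OnePoint ℂ) {b : ℂ} (hb : b ≠ 0) : b * chartDen p b = chartNum p b := by
  induction p using OnePoint.rec with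
  | infty => exact mul_inv_cancel₀ hb
  | coe x => exact mul_one b

lemma chartDen_ne_zero (p : OnePoint ℂ) {b : ℂ} (hb : b ≠ 0) : chartDen p b ≠ 0 := by
  induction p using OnePoint.rec with
  | infty => exact inv_ne_zero hb
  | coe x => exact one_ne_zero

lemma tendsto_add_punctured (x : ℂ) : Tendsto (fun z : ℂ => x + z) (𝓝[≠] 0) (𝓝 x) := by
  have h : Tendsto (fun z : ℂ => x + z) (𝓝 0) (𝓝 (x + 0)) := tendsto_const_nhds.add tendsto_id
  rw [add_zero] at h
  exact h.mono_left nhdsWithin_le_nhds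

lemma tendsto_pathTo (p : OnePoint ℂ) :
    Tendsto (pathTo p) (𝓝[≠] 0) (comap (↑) (𝓝 p)) := by
  induction p using OnePoint.rec with
  | infty =>
    rw [OnePoint.comap_coe_nhds_infty, coclosedCompact_eq_cocompact,
      ← Metric.cobounded_eq_cocompact]
    exact tendsto_inv₀_nhdsNE_zero
  | coe x =>
    rw [OnePoint.comap_coe_nhds]
    exact tendsto_add_punctured x

lemma eventually_add_ne_zero (x : ℂ) : ∀ᶠ z in 𝓝[≠] (0 : ℂ), x + z ≠ 0 := by
  by_cases hx : x = 0
  · filter_upwards [self_mem_nhdsWithin] with z hz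
    simpa [hx] using hz
  · exact (tendsto_add_punctured x).eventually_ne hx

lemma eventually_pathTo_ne_zero (p : OnePoint ℂ) : ∀ᶠ z in 𝓝[≠] 0, pathTo p z ≠ 0 := by
  induction p using OnePoint.rec with
  | infty =>
    filter_upwards [self_mem_nhdsWithin] with z hz
    exact inv_ne_zero hz
  | coe x => exact eventually_add_ne_zero x

/-- Along the curves, `chartNum - d * chartDen` stays away from zero. -/
lemma tendsto_num_sub_mul_den (p : OnePoint ℂ) (d : ℂ) :
    Tendsto (fun z => chartNum p (pathTo p z) - (d + z) * chartDen p (pathTo p z)) (𝓝[≠] 0)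
      (𝓝 (centreNum p - d * centreDen p)) :=
  ((tendsto_chartNum p).comp (tendsto_pathTo p)).sub
    ((tendsto_add_punctured d).mul ((tendsto_chartDen p).comp (tendsto_pathTo p)))

lemma centreNum_sub_ne_zero {p : OnePoint ℂ} {d : ℂ} (h : p ≠ d) :
    centreNum p - d * centreDen p ≠ 0 := by
  induction p using OnePoint.rec with
  | infty => simp [centreNum, centreDen]
  | coe x =>
    simp only [centreNum, centreDen, OnePoint.elim_some, id, mul_one]
    exact sub_ne_zero.2 fun e => h (congrArg _ e)

lemma invSub_eq_div (p : OnePoint ℂ) (d : ℂ) :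
    invSub p d = centreDen p / (centreNum p - d * centreDen p) := by
  induction p using OnePoint.rec with
  | infty => simp [centreNum, centreDen, invSub]
  | coe x => simp [centreNum, centreDen, invSub]

end Chart

/-! ### The ratio at weights in the Riemann sphere -/

section Limit

variable {k : ℕ} {φ : Pt × Pt → ℤ}

lemma tendsto_approach_apply (a : Pt → OnePoint ℂ) (f : Pt) :
    Tendsto (fun b : Pt → ℂ => b f) (approach k φ a) (comap (↑) (𝓝 (a f))) := by
  rw [tendsto_comap_iff]
  have h : Tendsto (fun (b : Pt → ℂ) (f : Pt) => (b f : OnePoint ℂ)) (approach k φ a) (𝓝 a) :=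
    tendsto_comap.mono_left inf_le_left
  exact (tendsto_pi_nhds.1 h) f

lemma eventually_mem_regularWeights (a : Pt → OnePoint ℂ) :
    ∀ᶠ b in approach k φ a, b ∈ regularWeights k φ :=
  (mem_inf_of_right (mem_principal_self _) : regularWeights k φ ∈ approach k φ a)

/-- The ratio function has a limit wherever its homogeneous denominator does not vanish. -/
lemma IsKasteleyn.tendsto_Y (hφ : IsKasteleyn k φ) (hk : 1 ≤ k) (a : Pt → OnePoint ℂ)
    (h : homogeneousZ k (fun x => centreNum (a (facePt x)))
      (fun x => centreDen (a (facePt x))) ≠ 0) :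
    ∃ y, Tendsto (fun b => Y k b φ) (approach k φ a) (𝓝 y) := by
  have hs : Tendsto (fun (b : Pt → ℂ) (x : FaceIndex k) => chartNum (a (facePt x)) (b (facePt x)))
      (approach k φ a) (𝓝 fun x => centreNum (a (facePt x))) :=
    tendsto_pi_nhds.2 fun x => (tendsto_chartNum _).comp (tendsto_approach_apply a _)
  have ht : Tendsto (fun (b : Pt → ℂ) (x : FaceIndex k) => chartDen (a (facePt x)) (b (facePt x)))
      (approach k φ a) (𝓝 fun x => centreDen (a (facePt x))) :=
    tendsto_pi_nhds.2 fun x => (tendsto_chartDen _).comp (tendsto_approach_apply a _)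
  have hc := continuous_homogeneousZ k
  refine ⟨_, (((hc.tendsto _).comp (ht.prodMk_nhds hs)).div
    ((hc.tendsto _).comp (hs.prodMk_nhds ht)) h).congr' ?_⟩
  filter_upwards [eventually_mem_regularWeights a] with b hb
  have hb0 : ∀ x, b (facePt x) ≠ 0 := fun x => hb.1 _ (facePt_mem x)
  exact (hφ.Y_eq_homogeneous hk hb (fun x => chartDen_ne_zero _ (hb0 x))
    fun x => mul_chartDen _ (hb0 x)).symm

/-- The hypotheses of the formula for the ratio function at weights in the sphere. -/
structure UniformWeights (k : ℕ) (a : Pt → OnePoint ℂ)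
    (c : Matrix (Fin (k + 1)) (Fin (k + 1)) (OnePoint ℂ)) (d : ℂ)
    (N : Matrix (Fin (k + 1)) (Fin (k + 1)) ℂ) : Prop where
  even : ∀ i j : Fin (k + 1), a (evenFace i j) = c i j
  odd : ∀ i j : Fin k, a (oddFace i j) = (d : OnePoint ℂ)
  ne : ∀ i j, c i j ≠ (d : OnePoint ℂ)
  inv : ∀ i j, N i j = invSub (c i j) d
  det : N.det ≠ 0

/-- The matrix `N` along the approximating curve. -/
noncomputable def pathMatrix (c : Matrix (Fin (k + 1)) (Fin (k + 1)) (OnePoint ℂ)) (d z : ℂ) :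
    Matrix (Fin (k + 1)) (Fin (k + 1)) ℂ :=
  Matrix.of fun i j => 1 / (pathTo (c i j) z - (d + z))

variable {a : Pt → OnePoint ℂ} {c : Matrix (Fin (k + 1)) (Fin (k + 1)) (OnePoint ℂ)} {d : ℂ}
  {N : Matrix (Fin (k + 1)) (Fin (k + 1)) ℂ}

lemma UniformWeights.eventually_good (h : UniformWeights k a c d N) :
    ∀ᶠ z in 𝓝[≠] (0 : ℂ), (∀ f ∈ faces k, pathTo (a f) z ≠ 0) ∧
      ∀ i j, chartNum (c i j) (pathTo (c i j) z) -
        (d + z) * chartDen (c i j) (pathTo (c i j) z) ≠ 0 := by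
  refine Eventually.and ((Finset.eventually_all _).2 fun f _ => eventually_pathTo_ne_zero _) ?_
  exact eventually_all.2 fun i => eventually_all.2 fun j =>
    (tendsto_num_sub_mul_den (c i j) d).eventually_ne (centreNum_sub_ne_zero (h.ne i j))

lemma chartNum_sub_eq {p : OnePoint ℂ} {b d : ℂ} (hb : b ≠ 0) :
    chartNum p b - d * chartDen p b = (b - d) * chartDen p b := by
  rw [← mul_chartDen p hb]
  ring

lemma UniformWeights.tendsto_pathMatrix (h : UniformWeights k a c d N) :
    Tendsto (pathMatrix c d) (𝓝[≠] 0) (𝓝 N) := by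
  refine tendsto_pi_nhds.2 fun i => tendsto_pi_nhds.2 fun j => ?_
  rw [h.inv, invSub_eq_div]
  refine (((tendsto_chartDen _).comp (tendsto_pathTo _)).div (tendsto_num_sub_mul_den (c i j) d)
    (centreNum_sub_ne_zero (h.ne i j))).congr' ?_
  filter_upwards [h.eventually_good] with z hz
  have h0 : pathTo (c i j) z ≠ 0 := by
    rw [← h.even]
    exact hz.1 _ (evenFace_mem i j)
  have h1 := chartDen_ne_zero (c i j) h0
  simp only [Pi.div_apply, Function.comp_apply, chartNum_sub_eq h0, pathMatrix, of_apply]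
  rw [div_mul_cancel_right₀ h1, one_div]

/-- All odd weights follow the same curve `d + z`, so the finite formula applies at each small `z ≠
0`; the shift by `z` also moves zero weights away from `0`. -/
lemma UniformWeights.eventually_ratio (h : UniformWeights k a c d N) (hφ : IsKasteleyn k φ)
    (hk : 1 ≤ k) :
    ∀ᶠ z in 𝓝[≠] (0 : ℂ), (fun f => pathTo (a f) z) ∈ regularWeights k φ ∧
      Y k (fun f => pathTo (a f) z) φ = (d + z) + ∑ i, ∑ j, (pathMatrix c d z)⁻¹ i j := by
  have hdet := ((Continuous.matrix_det continuous_id).tendsto N).comp h.tendsto_pathMatrix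
  filter_upwards [h.eventually_good, hdet.eventually_ne h.det] with z hz hdz
  have := hφ.ratio_eq hk (fun f => pathTo (a f) z) (Matrix.of fun i j => pathTo (c i j) z) (d + z)
    (pathMatrix c d z) (fun i j => by simp [h.even]) (fun i j => by simp [h.odd, pathTo])
    (fun i j e => ?_) (fun i j => rfl) hz.1 hdz
  · exact ⟨⟨hz.1, this.1⟩, this.2⟩
  · have h0 : pathTo (c i j) z ≠ 0 := by
      rw [← h.even]
      exact hz.1 _ (evenFace_mem i j)
    apply hz.2 i j
    rw [of_apply] at e
    rw [chartNum_sub_eq h0, e, sub_self, zero_mul]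

lemma UniformWeights.tendsto_approach (h : UniformWeights k a c d N) (hφ : IsKasteleyn k φ)
    (hk : 1 ≤ k) :
    Tendsto (fun (z : ℂ) (f : Pt) => pathTo (a f) z) (𝓝[≠] 0) (approach k φ a) := by
  refine tendsto_inf.2 ⟨tendsto_comap_iff.2 (tendsto_pi_nhds.2 fun f => ?_), ?_⟩
  · exact tendsto_comap_iff.1 (tendsto_pathTo (a f))
  · exact tendsto_principal.2 ((h.eventually_ratio hφ hk).mono fun z hz => hz.1)

/-- Along the curve, clearing denominators in the determinant formula for `Z` turns each `c - d`
into `chartNum - (d + z) * chartDen`. These factors and `det N` all have nonzero limits. -/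
lemma UniformWeights.homogeneousZ_ne_zero (h : UniformWeights k a c d N) (hφ : IsKasteleyn k φ)
    (hk : 1 ≤ k) :
    homogeneousZ k (fun x => centreNum (a (facePt x))) (fun x => centreDen (a (facePt x))) ≠ 0 := by
  obtain ⟨ε, hε, hZ⟩ := hφ.exists_Z_eq_det hk
  obtain ⟨η, hη, hU⟩ := hφ.exists_Z_eq_uniform hk
  have hη0 : η ≠ 0 := by rcases hη with rfl | rfl <;> simp
  have hs : Tendsto (fun (z : ℂ) (x : FaceIndex k) =>
      chartNum (a (facePt x)) (pathTo (a (facePt x)) z))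
      (𝓝[≠] 0) (𝓝 fun x => centreNum (a (facePt x))) :=
    tendsto_pi_nhds.2 fun x => (tendsto_chartNum _).comp (tendsto_pathTo _)
  have ht : Tendsto (fun (z : ℂ) (x : FaceIndex k) =>
      chartDen (a (facePt x)) (pathTo (a (facePt x)) z))
      (𝓝[≠] 0) (𝓝 fun x => centreDen (a (facePt x))) :=
    tendsto_pi_nhds.2 fun x => (tendsto_chartDen _).comp (tendsto_pathTo _)
  have h1 := (((continuous_homogeneousZ k).tendsto _).comp (hs.prodMk_nhds ht)).const_mul ε
  have h2 : Tendsto (fun z => η * (∏ i, ∏ j, (chartNum (c i j) (pathTo (c i j) z) -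
        (d + z) * chartDen (c i j) (pathTo (c i j) z))) * (pathMatrix c d z).det) (𝓝[≠] 0)
      (𝓝 (η * (∏ i, ∏ j, (centreNum (c i j) - d * centreDen (c i j))) * N.det)) := by
    refine ((tendsto_finsetProd _ fun i _ => tendsto_finsetProd _ fun j _ =>
      tendsto_num_sub_mul_den (c i j) d).const_mul η).mul
      (((Continuous.matrix_det continuous_id).tendsto N).comp h.tendsto_pathMatrix)
  have heq : (fun z => η * (∏ i, ∏ j, (chartNum (c i j) (pathTo (c i j) z) -
        (d + z) * chartDen (c i j) (pathTo (c i j) z))) * (pathMatrix c d z).det) =ᶠ[𝓝[≠] 0]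
      fun z => ε * homogeneousZ k (fun x => chartNum (a (facePt x)) (pathTo (a (facePt x)) z))
        fun x => chartDen (a (facePt x)) (pathTo (a (facePt x)) z) := by
    filter_upwards [h.eventually_good] with z hz
    have h0 : ∀ i j, pathTo (c i j) z ≠ 0 := fun i j => by
      rw [← h.even]
      exact hz.1 _ (evenFace_mem i j)
    have hne : ∀ i j, pathTo (c i j) z ≠ d + z := fun i j e => by
      apply hz.2 i j
      rw [chartNum_sub_eq (h0 i j), e, sub_self, zero_mul]
    rw [homogeneousZ_eq (a := fun f => pathTo (a f) z)
      (fun x => chartDen_ne_zero _ (hz.1 _ (facePt_mem x)))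
      (fun x => mul_chartDen _ (hz.1 _ (facePt_mem x))), mul_left_comm, ← hZ,
      hU (fun f => pathTo (a f) z) (Matrix.of fun i j => pathTo (c i j) z) (d + z)
        (fun i j => by simp [h.even]) (fun i j => by simp [h.odd, pathTo]) hne,
      Fintype.prod_sum_type, Fintype.prod_prod_type]
    have hodd : ∏ x : Fin k × Fin k, chartDen (a (facePt (Sum.inr x)))
        (pathTo (a (facePt (Sum.inr x))) z) = 1 :=
      Finset.prod_eq_one fun x _ => by simp [facePt, h.odd, chartDen]
    rw [hodd]
    simp only [chartNum_sub_eq (h0 _ _), Finset.prod_mul_distrib, facePt, Sum.elim_inl,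
      h.even, of_apply]
    rw [pathMatrix]
    ring
  have hlim := tendsto_nhds_unique (h2.congr' heq) h1
  intro h0
  simp only [h0, mul_zero] at hlim
  refine mul_ne_zero (mul_ne_zero hη0 ?_) h.det hlim
  exact Finset.prod_ne_zero_iff.2 fun i _ => Finset.prod_ne_zero_iff.2 fun j _ =>
    centreNum_sub_ne_zero (h.ne i j)

lemma UniformWeights.hasRatio (h : UniformWeights k a c d N) (hφ : IsKasteleyn k φ)
    (hk : 1 ≤ k) :
    HasRatio k φ a ((d + ∑ i, ∑ j, N⁻¹ i j : ℂ) : OnePoint ℂ) := by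
  have happ := h.tendsto_approach hφ hk
  obtain ⟨y, hy⟩ := hφ.tendsto_Y hk a (h.homogeneousZ_ne_zero hφ hk)
  have hinv : Tendsto (fun z => (pathMatrix c d z)⁻¹) (𝓝[≠] 0) (𝓝 N⁻¹) := by
    simp only [Matrix.inv_def, Ring.inverse_eq_inv']
    exact ((((Continuous.matrix_det continuous_id).tendsto N).comp h.tendsto_pathMatrix).inv₀
      h.det).smul (((Continuous.matrix_adjugate continuous_id).tendsto N).comp h.tendsto_pathMatrix)
  have hlim : Tendsto (fun z => (d + z) + ∑ i, ∑ j, (pathMatrix c d z)⁻¹ i j) (𝓝[≠] 0)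
      (𝓝 (d + ∑ i, ∑ j, N⁻¹ i j)) :=
    (tendsto_add_punctured d).add (tendsto_finsetSum _ fun i _ => tendsto_finsetSum _ fun j _ =>
      tendsto_pi_nhds.1 (tendsto_pi_nhds.1 hinv i) j)
  have hyz := (hlim.congr' ((h.eventually_ratio hφ hk).mono fun z hz => hz.2.symm))
  -- The limit over all regular weights exists, so the single curve determines it; the same curve
  -- shows that the approach filter is nontrivial.
  rw [tendsto_nhds_unique hyz (hy.comp happ)]
  exact ⟨happ.neBot, (OnePoint.continuous_coe.tendsto y).comp hy⟩

end Limit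

end AztecDimers

theorem corollary5p6 (k : ℕ) (hk : 1 ≤ k) (φ : AztecDimers.Pt × AztecDimers.Pt → ℤ)
    (hφ : AztecDimers.IsKasteleyn k φ) :
    -- the partition function; the sign depends on `k` and `φ` only
    (∃ ε : ℂ, (ε = 1 ∨ ε = -1) ∧
      ∀ (a : AztecDimers.Pt → ℂ) (c : Matrix (Fin (k + 1)) (Fin (k + 1)) ℂ) (d : ℂ),
        (∀ i j : Fin (k + 1), a (AztecDimers.evenFace i j) = c i j) →
        (∀ i j : Fin k, a (AztecDimers.oddFace i j) = d) →
        (∀ i j, c i j ≠ d) →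
        AztecDimers.Z k a φ =
          ε * (∏ i, ∏ j, (c i j - d)) * (Matrix.of fun i j => 1 / (c i j - d)).det) ∧
    -- the ratio function at finite nonzero weights, where its defining formula applies literally
    (∀ (a : AztecDimers.Pt → ℂ) (c : Matrix (Fin (k + 1)) (Fin (k + 1)) ℂ) (d : ℂ)
        (N : Matrix (Fin (k + 1)) (Fin (k + 1)) ℂ),
        (∀ i j : Fin (k + 1), a (AztecDimers.evenFace i j) = c i j) →
        (∀ i j : Fin k, a (AztecDimers.oddFace i j) = d) →
        (∀ i j, c i j ≠ d) →
        (∀ i j, N i j = 1 / (c i j - d)) →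
        (∀ f ∈ AztecDimers.faces k, a f ≠ 0) →
        N.det ≠ 0 →
        AztecDimers.Z k a φ ≠ 0 ∧ AztecDimers.Y k a φ = d + ∑ i, ∑ j, N⁻¹ i j) ∧
    -- the ratio function at arbitrary weights: `0` is allowed everywhere, `∞` on the even faces
    (∀ (a : AztecDimers.Pt → OnePoint ℂ) (c : Matrix (Fin (k + 1)) (Fin (k + 1)) (OnePoint ℂ))
        (d : ℂ) (N : Matrix (Fin (k + 1)) (Fin (k + 1)) ℂ),
        (∀ i j : Fin (k + 1), a (AztecDimers.evenFace i j) = c i j) →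
        (∀ i j : Fin k, a (AztecDimers.oddFace i j) = (d : OnePoint ℂ)) →
        (∀ i j, c i j ≠ (d : OnePoint ℂ)) →
        (∀ i j, N i j = AztecDimers.invSub (c i j) d) →
        N.det ≠ 0 →
        AztecDimers.HasRatio k φ a ((d + ∑ i, ∑ j, N⁻¹ i j : ℂ) : OnePoint ℂ)) :=
  ⟨hφ.exists_Z_eq_uniform hk, hφ.ratio_eq hk, fun _ _ _ _ h1 h2 h3 h4 h5 =>
    AztecDimers.UniformWeights.hasRatio ⟨h1, h2, h3, h4, h5⟩ hφ hk⟩
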